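/- Let $N,D,K\ge 1$ and $m\ge 2$ be integers. For points $x_1,\dots,x_N\in\mathbb{R}^D$ with weights $w_1,\dots,w_N\in\mathbb{Q}_{\ge 0}$, means $C=(\mu_k)_{k=1}^K$ in $\mathbb{R}^D$ and memberships $R=(r_{nk})$ with $r_{nk}\in[0,1]$ and $\sum_{k=1}^K r_{nk}=1$ for all $n$, the fuzzy $K$-means cost with fuzzifier $m$ is $$\phi_X^{(m)}(C,R)=\sum_{n=1}^N\sum_{k=1}^K r_{nk}^m\, w_n\,\|x_n-\mu_k\|^2 ,$$ and $\phi^{OPT}_{(X,K,m)}$ denotes its minimum over all such $(C,R)$. There is a single deterministic algorithm (a real RAM program whose only operations on real numbers are $+,-,\cdot,/$ and exact comparison, each at unit cost, and whose only operations on integers are addition, subtraction and comparison) that, given $X=\{(x_n,w_n)\}_{n=1}^N\subset\mathbb{R}^D\times\mathbb{Q}_{\ge 0}$, $K$, $m$ and $\epsilon\in(0,1]$, halts with a solution $(C,R)$ such that $$\phi_X^{(m)}(C,R)\le(1+\epsilon)\,\phi^{OPT}_{(X,K,m)} .$$ With $w_{\max}=\max_n w_n$ and $w_{\min}=\min_n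 w_n$, its running time is at most $$D\cdot \max\{N,2\}^{\,\mathcal{O}\left(K^2\log(\max\{K,2\})\cdot\frac1\epsilon\left(m\log\left(\frac m\epsilon\right)+\log\left(\frac{w_{\max}}{w_{\min}}\right)\right)\right)}$$ whenever $w_{\min}>0$, where the constant in $\mathcal{O}(\cdot)$ is absolute. For fixed $K$ and $m$ the algorithm is a PTAS: for all fixed $K$, $m$ and $\epsilon$ there is an $a\in\mathbb{N}$ such that its running time on every input is at most $a\,D\,N^a$. -/

import Mathlib

open scoped BigOperators

noncomputable section

/-! # The fuzzy K-means problem -/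

/-- The cost `∑ₙ ∑ₖ rₙₖᵐ wₙ ‖xₙ - μₖ‖²` of the means `μ` and the memberships `r`
on the points `x` with weights `w`. -/
def fuzzyCost {N D K : ℕ} (m : ℕ) (x : Fin N → EuclideanSpace ℝ (Fin D)) (w : Fin N → ℝ)
    (μ : Fin K → EuclideanSpace ℝ (Fin D)) (r : Fin N → Fin K → ℝ) : ℝ :=
  ∑ n, ∑ k, r n k ^ m * w n * ‖x n - μ k‖ ^ 2

/-- Admissible memberships: values in `[0,1]`, and the memberships of every point sum to `1`. -/
def IsMembership {N K : ℕ} (r : Fin N → Fin K → ℝ) : Prop :=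
  (∀ n k, 0 ≤ r n k ∧ r n k ≤ 1) ∧ ∀ n, ∑ k, r n k = 1

/-- The optimal cost: the infimum of the cost over all means and all admissible memberships. -/
def optCost {N D : ℕ} (K m : ℕ) (x : Fin N → EuclideanSpace ℝ (Fin D)) (w : Fin N → ℝ) : ℝ :=
  sInf {c | ∃ (μ : Fin K → EuclideanSpace ℝ (Fin D)) (r : Fin N → Fin K → ℝ),
    IsMembership r ∧ c = fuzzyCost m x w μ r}

/-! # Real RAM programs

The memory consists of arrays of natural numbers (for counters and addresses) and arrays of real
numbers. Array names are constants of the program, so that a program uses finitely many arrays;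
the position in an array may be computed (indirect addressing). On natural numbers a program can
add, subtract (truncated at `0`) and compare; on real numbers it can add, subtract, multiply,
divide and compare exactly. There are no roots, no rounding, and no conversion from reals to
natural numbers. Every elementary operation costs one step. -/

namespace RealRAM

/-- Memory contents: `nat a i` and `real a i` are cell `i` of array `a`. -/
structure Store where
  nat : ℕ → ℕ → ℕ
  real : ℕ → ℕ → ℝ

/-- Expressions for natural numbers. -/
inductive NatExpr where
  | lit (k : ℕ)
  | get (a : ℕ) (i : NatExpr)
  | add (e f : NatExpr)
  | sub (e f : NatExpr)

/-- Expressions for real numbers. -/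
inductive RealExpr where
  | ofNat (e : NatExpr)
  | get (a : ℕ) (i : NatExpr)
  | add (e f : RealExpr)
  | sub (e f : RealExpr)
  | mul (e f : RealExpr)
  | div (e f : RealExpr)

/-- Tests. -/
inductive Test where
  | natLt (e f : NatExpr)
  | realLt (e f : RealExpr)
  | not (b : Test)
  | and (b c : Test)

/-- Programs. -/
inductive Program where
  | skip
  | setNat (a : ℕ) (i e : NatExpr)
  | setReal (a : ℕ) (i : NatExpr) (e : RealExpr)
  | seq (p q : Program)
  | ite (b : Test) (p q : Program)
  | while (b : Test) (p : Program)

/-- The value of an expression. -/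
def NatExpr.eval (s : Store) : NatExpr → ℕ
  | lit k => k
  | get a i => s.nat a (i.eval s)
  | add e f => e.eval s + f.eval s
  | sub e f => e.eval s - f.eval s

/-- The number of operations in an expression. -/
def NatExpr.cost : NatExpr → ℕ
  | lit _ => 1
  | get _ i => i.cost + 1
  | add e f => e.cost + f.cost + 1
  | sub e f => e.cost + f.cost + 1

/-- The value of an expression; a division by zero returns `0`. -/
def RealExpr.eval (s : Store) : RealExpr → ℝ
  | ofNat e => (e.eval s : ℝ)
  | get a i => s.real a (i.eval s)
  | add e f => e.eval s + f.eval s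
  | sub e f => e.eval s - f.eval s
  | mul e f => e.eval s * f.eval s
  | div e f => e.eval s / f.eval s

/-- The number of operations in an expression. -/
def RealExpr.cost : RealExpr → ℕ
  | ofNat e => e.cost + 1
  | get _ i => i.cost + 1
  | add e f => e.cost + f.cost + 1
  | sub e f => e.cost + f.cost + 1
  | mul e f => e.cost + f.cost + 1
  | div e f => e.cost + f.cost + 1

/-- The outcome of a test. -/
def Test.Holds (s : Store) : Test → Prop
  | natLt e f => e.eval s < f.eval s
  | realLt e f => e.eval s < f.eval s
  | not b => ¬ b.Holds s
  | and b c => b.Holds s ∧ c.Holds s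

/-- The number of operations in a test. -/
def Test.cost : Test → ℕ
  | natLt e f => e.cost + f.cost + 1
  | realLt e f => e.cost + f.cost + 1
  | not b => b.cost + 1
  | and b c => b.cost + c.cost + 1

/-- Overwrite cell `i` of the array `a` of natural numbers. -/
def Store.writeNat (s : Store) (a i v : ℕ) : Store :=
  { s with nat := Function.update s.nat a (Function.update (s.nat a) i v) }

/-- Overwrite cell `i` of the array `a` of real numbers. -/
def Store.writeReal (s : Store) (a i : ℕ) (v : ℝ) : Store :=
  { s with real := Function.update s.real a (Function.update (s.real a) i v) }

/-- `Run p s t s'`: started on the memory contents `s`, the program `p` halts after exactly `t`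
steps with the memory contents `s'`. -/
inductive Run : Program → Store → ℕ → Store → Prop where
  | skip (s : Store) : Run .skip s 1 s
  | setNat (s : Store) (a : ℕ) (i e : NatExpr) :
      Run (.setNat a i e) s (i.cost + e.cost + 1) (s.writeNat a (i.eval s) (e.eval s))
  | setReal (s : Store) (a : ℕ) (i : NatExpr) (e : RealExpr) :
      Run (.setReal a i e) s (i.cost + e.cost + 1) (s.writeReal a (i.eval s) (e.eval s))
  | seq {p q : Program} {s s₁ s₂ : Store} {t₁ t₂ : ℕ} :
      Run p s t₁ s₁ → Run q s₁ t₂ s₂ → Run (.seq p q) s (t₁ + t₂) s₂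
  | iteTrue {b : Test} {p q : Program} {s s₁ : Store} {t : ℕ} :
      b.Holds s → Run p s t s₁ → Run (.ite b p q) s (b.cost + 1 + t) s₁
  | iteFalse {b : Test} {p q : Program} {s s₁ : Store} {t : ℕ} :
      ¬ b.Holds s → Run q s t s₁ → Run (.ite b p q) s (b.cost + 1 + t) s₁
  | whileTrue {b : Test} {p : Program} {s s₁ s₂ : Store} {t₁ t₂ : ℕ} :
      b.Holds s → Run p s t₁ s₁ → Run (.while b p) s₁ t₂ s₂ →
      Run (.while b p) s (b.cost + 1 + t₁ + t₂) s₂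
  | whileFalse {b : Test} {p : Program} {s : Store} :
      ¬ b.Holds s → Run (.while b p) s (b.cost + 1) s

/-- Programs are deterministic: the running time and the result are determined by the input. -/
theorem Run.unique {p : Program} {s s₁ s₂ : Store} {t₁ t₂ : ℕ}
    (h₁ : Run p s t₁ s₁) (h₂ : Run p s t₂ s₂) : t₁ = t₂ ∧ s₁ = s₂ := by
  induction h₁ generalizing t₂ s₂ with
  | skip s => cases h₂; exact ⟨rfl, rfl⟩
  | setNat s a i e => cases h₂; exact ⟨rfl, rfl⟩
  | setReal s a i e => cases h₂; exact ⟨rfl, rfl⟩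
  | seq _ _ ih₁ ih₂ =>
    cases h₂ with
    | seq g₁ g₂ =>
      obtain ⟨rfl, rfl⟩ := ih₁ g₁
      obtain ⟨rfl, rfl⟩ := ih₂ g₂
      exact ⟨rfl, rfl⟩
  | iteTrue hb _ ih =>
    cases h₂ with
    | iteTrue _ g => obtain ⟨rfl, rfl⟩ := ih g; exact ⟨rfl, rfl⟩
    | iteFalse hb' _ => exact absurd hb hb'
  | iteFalse hb _ ih =>
    cases h₂ with
    | iteTrue hb' _ => exact absurd hb' hb
    | iteFalse _ g => obtain ⟨rfl, rfl⟩ := ih g; exact ⟨rfl, rfl⟩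
  | whileTrue hb _ _ ih₁ ih₂ =>
    cases h₂ with
    | whileTrue _ g₁ g₂ =>
      obtain ⟨rfl, rfl⟩ := ih₁ g₁
      obtain ⟨rfl, rfl⟩ := ih₂ g₂
      exact ⟨rfl, rfl⟩
    | whileFalse hb' => exact absurd hb hb'
  | whileFalse hb =>
    cases h₂ with
    | whileTrue hb' _ _ => exact absurd hb' hb
    | whileFalse _ => exact ⟨rfl, rfl⟩

/-- The input of a fuzzy K-means program: cells 0, 1, 2, 3 of the array 0 of natural numbers hold
`N`, `D`, `K`, `m`; cell 0 of the real array 0 holds `ε`; the real array 1 holds the coordinates of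
the points, point after point; the real array 2 holds the weights. All other cells hold `0`. -/
def input {N D : ℕ} (K m : ℕ) (ε : ℝ) (x : Fin N → EuclideanSpace ℝ (Fin D)) (w : Fin N → ℝ) :
    Store where
  nat a i :=
    match a, i with
    | 0, 0 => N
    | 0, 1 => D
    | 0, 2 => K
    | 0, 3 => m
    | _, _ => 0
  real a i :=
    match a with
    | 0 => if i = 0 then ε else 0
    | 1 => if h : i < N * D then x (Fin.divNat ⟨i, h⟩) (Fin.modNat ⟨i, h⟩) else 0
    | 2 => if h : i < N then w ⟨i, h⟩ else 0
    | _ => 0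

/-- The computed means: their coordinates, mean after mean, are in the real array 3. -/
def outputMeans (D K : ℕ) (s : Store) : Fin K → EuclideanSpace ℝ (Fin D) :=
  fun k => WithLp.toLp 2 fun d => s.real 3 (k * D + d)

/-- The computed memberships: they are in the real array 4, point after point. -/
def outputMemberships (N K : ℕ) (s : Store) : Fin N → Fin K → ℝ :=
  fun n k => s.real 4 (n * K + k)

end RealRAM

end

open scoped BigOperators

noncomputable section

/-! # Program logic for the real RAM -/

namespace RealRAM

/-! The algorithm is an exhaustive search over sample means, with `L = ⌈8 / ε⌉₊`. Three facts carry
it.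

Means. For fixed memberships the cost splits over the means; mean `k` sees point `n` with weight `r
n k ^ m * w n`. The average of `L` points drawn with these weights has expected squared distance
variance over `L` from the centroid, so some sample of size `L` costs at most `1 + 1 / L` times the
optimum (`exists_sample_mean_cost_le`). Trying all `N ^ (K * L)` families of samples therefore
suffices, and the unknown memberships never have to be guessed (`exists_candidateMeans_cost_le`).

Memberships. For fixed means the points separate. With squared distances `a k` and minimum `b`,
optimal memberships are proportional to `(b / a k) ^ (1 / (m - 1))` when `b > 0`. Roots are
unavailable, so these numbers are rounded down to the grid of width `1 / (m * K * L)`. Radon's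
inequality shows that this loses at most the factor `ρ = (1 - 1 / L)⁻¹` (`nearOptimal_gridRoots`),
also when a point coincides with a mean.

Search. The candidate of least computed cost is stored and evaluated again at the end. Each
evaluation accounts for one factor `ρ`, and `ρ * (ρ * (1 + 1 / L)) ≤ 1 + ε` (`approx_factor_le`).

Running times are bounded by `(D + 1) * (U + 4) ^ e`, where `U` bounds every size other than `D`.
Each construct of the language raises `e` by a constant, so the whole program gets a numeral, 140.
With `U` a power of `max N 2` of exponent `K * L * m` this is the first bound; with `U = H * N ^ H`,
`H = K * L * m`, it is the polynomial one. Of the logarithm of the weight ratio only its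
nonnegativity is used. -/

@[simp] theorem Store.writeNat_real (s : Store) (a i v : ℕ) :
    (s.writeNat a i v).real = s.real := rfl

@[simp] theorem Store.writeReal_nat (s : Store) (a i : ℕ) (v : ℝ) :
    (s.writeReal a i v).nat = s.nat := rfl

@[simp] theorem Store.writeNat_nat_self (s : Store) (a i v : ℕ) :
    (s.writeNat a i v).nat a i = v := by
  simp [Store.writeNat]

@[simp] theorem Store.writeReal_real_self (s : Store) (a i : ℕ) (v : ℝ) :
    (s.writeReal a i v).real a i = v := by
  simp [Store.writeReal]

@[simp] theorem Store.writeNat_nat_of_ne (s : Store) {a b : ℕ} (i v : ℕ) (h : b ≠ a) :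
    (s.writeNat a i v).nat b = s.nat b := by
  simp [Store.writeNat, Function.update_of_ne h]

@[simp] theorem Store.writeReal_real_of_ne (s : Store) {a b : ℕ} (i : ℕ) (v : ℝ) (h : b ≠ a) :
    (s.writeReal a i v).real b = s.real b := by
  simp [Store.writeReal, Function.update_of_ne h]

theorem Store.writeNat_nat_cell_of_ne (s : Store) (a : ℕ) {i j : ℕ} (v : ℕ) (h : j ≠ i) :
    (s.writeNat a i v).nat a j = s.nat a j := by
  simp [Store.writeNat, Function.update_of_ne h]

theorem Store.writeReal_real_cell_of_ne (s : Store) (a : ℕ) {i j : ℕ} (v : ℝ) (h : j ≠ i) :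
    (s.writeReal a i v).real a j = s.real a j := by
  simp [Store.writeReal, Function.update_of_ne h]

/-- Whether the program contains an assignment to the array `b` of natural numbers. -/
def Program.writesNat : Program → ℕ → Bool
  | skip, _ => false
  | setNat a _ _, b => a == b
  | setReal _ _ _, _ => false
  | seq p q, b => p.writesNat b || q.writesNat b
  | ite _ p q, b => p.writesNat b || q.writesNat b
  | .while _ p, b => p.writesNat b

/-- Whether the program contains an assignment to the array `b` of real numbers. -/
def Program.writesReal : Program → ℕ → Bool
  | skip, _ => false
  | setNat _ _ _, _ => false
  | setReal a _ _, b => a == b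
  | seq p q, b => p.writesReal b || q.writesReal b
  | ite _ p q, b => p.writesReal b || q.writesReal b
  | .while _ p, b => p.writesReal b

/-- The stores agree on all arrays which the program does not write. -/
structure Frame (p : Program) (s s' : Store) : Prop where
  nat : ∀ a, p.writesNat a = false → s'.nat a = s.nat a
  real : ∀ a, p.writesReal a = false → s'.real a = s.real a

theorem Frame.refl (p : Program) (s : Store) : Frame p s s := ⟨fun _ _ => rfl, fun _ _ => rfl⟩

theorem Frame.trans {p : Program} {s s₁ s₂ : Store} (h : Frame p s s₁) (h' : Frame p s₁ s₂) :
    Frame p s s₂ :=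
  ⟨fun a ha => (h'.nat a ha).trans (h.nat a ha), fun a ha => (h'.real a ha).trans (h.real a ha)⟩

theorem Frame.of_subprogram {p q : Program} {s s' : Store} (h : Frame p s s')
    (hn : ∀ a, q.writesNat a = false → p.writesNat a = false)
    (hr : ∀ a, q.writesReal a = false → p.writesReal a = false) : Frame q s s' :=
  ⟨fun a ha => h.nat a (hn a ha), fun a ha => h.real a (hr a ha)⟩

/-- This replaces explicit bookkeeping of untouched arrays in all later invariants. Since
`writesNat` and `writesReal` are Boolean functions of the program text, the side conditions for
concrete programs are closed by `rfl`. -/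
theorem Run.frame {p : Program} {s s' : Store} {t : ℕ} (h : Run p s t s') : Frame p s s' := by
  induction h with
  | skip s => exact Frame.refl _ _
  | setNat s a i e =>
    refine ⟨fun b hb => ?_, fun _ _ => rfl⟩
    have : b ≠ a := by rintro rfl; simp [Program.writesNat] at hb
    simp [this]
  | setReal s a i e =>
    refine ⟨fun _ _ => rfl, fun b hb => ?_⟩
    have : b ≠ a := by rintro rfl; simp [Program.writesReal] at hb
    simp [this]
  | seq _ _ ih₁ ih₂ =>
    refine (ih₁.of_subprogram ?_ ?_).trans (ih₂.of_subprogram ?_ ?_) <;>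
      simp +contextual [Program.writesNat, Program.writesReal]
  | iteTrue _ _ ih =>
    refine ih.of_subprogram ?_ ?_ <;> simp +contextual [Program.writesNat, Program.writesReal]
  | iteFalse _ _ ih =>
    refine ih.of_subprogram ?_ ?_ <;> simp +contextual [Program.writesNat, Program.writesReal]
  | whileTrue _ _ _ ih₁ ih₂ =>
    exact (ih₁.of_subprogram (q := .while _ _) (fun _ h => h) (fun _ h => h)).trans ih₂
  | whileFalse _ => exact Frame.refl _ _

/-- Started on `s`, the program `p` halts within `(D + 1) * (U + 4) ^ e` steps, with memory
contents satisfying `Q`. -/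
def Ends (D U : ℕ) (p : Program) (s : Store) (e : ℕ) (Q : Store → Prop) : Prop :=
  ∃ t s', Run p s t s' ∧ t ≤ (D + 1) * (U + 4) ^ e ∧ Q s'

theorem time_mono {D U e e' : ℕ} (h : e ≤ e') : (D + 1) * (U + 4) ^ e ≤ (D + 1) * (U + 4) ^ e' :=
  Nat.mul_le_mul_left _ (Nat.pow_le_pow_right (by omega) h)

/-- The summand 4 in `U + 4` makes the base at least 4, so that three powers absorb every constant
up to 64, even for `D = U = 0`. -/
theorem const_le_time (D U : ℕ) {c e : ℕ} (h : c ≤ 64) (he : 3 ≤ e) :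
    c ≤ (D + 1) * (U + 4) ^ e := by
  have h₁ : 4 ^ 3 ≤ (U + 4) ^ 3 := Nat.pow_le_pow_left (by omega) 3
  have h₂ : (0 + 1) * (U + 4) ^ 3 ≤ (D + 1) * (U + 4) ^ 3 := Nat.mul_le_mul_right _ (by omega)
  have h₃ := time_mono (D := D) (U := U) he
  omega

theorem time_add_const_le {D U e t c : ℕ} (h : t ≤ (D + 1) * (U + 4) ^ e) (hc : c ≤ 12) :
    t + c ≤ (D + 1) * (U + 4) ^ (e + 2) := by
  have h₁ : 1 ≤ (D + 1) * (U + 4) ^ e := Nat.mul_pos (by omega) (Nat.pow_pos (by omega))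
  have h₂ : 4 ^ 2 ≤ (U + 4) ^ 2 := Nat.pow_le_pow_left (by omega) 2
  rw [pow_add, ← mul_assoc]
  nlinarith

theorem time_add_le {D U e t₁ t₂ : ℕ} (h₁ : t₁ ≤ (D + 1) * (U + 4) ^ e)
    (h₂ : t₂ ≤ (D + 1) * (U + 4) ^ e) : t₁ + t₂ ≤ (D + 1) * (U + 4) ^ (e + 1) := by
  rw [pow_succ, ← mul_assoc]
  nlinarith [Nat.zero_le ((D + 1) * (U + 4) ^ e * U)]

namespace Ends

variable {D U e : ℕ} {p q : Program} {s : Store} {Q R : Store → Prop}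

/-- Besides raising the exponent, weakening makes the frame available when the new postcondition is
proved. In a sequence both parts are first raised to a common exponent this way. -/
theorem mono {e' : ℕ} (h : Ends D U p s e Q) (he : e ≤ e') (hQ : ∀ s', Frame p s s' → Q s' → R s') :
    Ends D U p s e' R := by
  obtain ⟨t, s', hr, ht, hs⟩ := h
  exact ⟨t, s', hr, ht.trans (time_mono he), hQ s' hr.frame hs⟩

theorem skip (h : Q s) (he : 3 ≤ e) : Ends D U .skip s e Q :=
  ⟨_, _, .skip s, const_le_time D U (by norm_num) he, h⟩

theorem setNat {a : ℕ} {i f : NatExpr} (h : Q (s.writeNat a (i.eval s) (f.eval s)))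
    (hc : i.cost + f.cost ≤ 60 := by decide) (he : 3 ≤ e := by decide) :
    Ends D U (.setNat a i f) s e Q :=
  ⟨_, _, .setNat s a i f, const_le_time D U (by omega) he, h⟩

theorem setReal {a : ℕ} {i : NatExpr} {f : RealExpr}
    (h : Q (s.writeReal a (i.eval s) (f.eval s)))
    (hc : i.cost + f.cost ≤ 60 := by decide) (he : 3 ≤ e := by decide) :
    Ends D U (.setReal a i f) s e Q :=
  ⟨_, _, .setReal s a i f, const_le_time D U (by omega) he, h⟩

theorem seq (h : Ends D U p s e R) (h' : ∀ s', Frame p s s' → R s' → Ends D U q s' e Q) :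
    Ends D U (.seq p q) s (e + 1) Q := by
  obtain ⟨t, s₁, hr, ht, hs⟩ := h
  obtain ⟨t', s₂, hr', ht', hs'⟩ := h' s₁ hr.frame hs
  exact ⟨_, _, .seq hr hr', time_add_le ht ht', hs'⟩

theorem setNat_seq {a : ℕ} {i f : NatExpr}
    (h : Ends D U q (s.writeNat a (i.eval s) (f.eval s)) e Q)
    (hc : i.cost + f.cost ≤ 60 := by decide) (he : 3 ≤ e := by decide) :
    Ends D U (.seq (.setNat a i f) q) s (e + 1) Q :=
  seq (R := fun s' => s' = s.writeNat a (i.eval s) (f.eval s)) (setNat rfl hc he)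
    (by rintro _ _ rfl; exact h)

theorem setReal_seq {a : ℕ} {i : NatExpr} {f : RealExpr}
    (h : Ends D U q (s.writeReal a (i.eval s) (f.eval s)) e Q)
    (hc : i.cost + f.cost ≤ 60 := by decide) (he : 3 ≤ e := by decide) :
    Ends D U (.seq (.setReal a i f) q) s (e + 1) Q :=
  seq (R := fun s' => s' = s.writeReal a (i.eval s) (f.eval s)) (setReal rfl hc he)
    (by rintro _ _ rfl; exact h)

theorem ite {b : Test} (hp : b.Holds s → Ends D U p s e Q) (hq : ¬ b.Holds s → Ends D U q s e Q)
    (hc : b.cost ≤ 40 := by decide) (he : 3 ≤ e := by decide) :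
    Ends D U (.ite b p q) s (e + 1) Q := by
  by_cases h : b.Holds s
  · obtain ⟨t, s', hr, ht, hs⟩ := hp h
    exact ⟨_, _, .iteTrue h hr, time_add_le (const_le_time D U (by omega) he) ht, hs⟩
  · obtain ⟨t, s', hr, ht, hs⟩ := hq h
    exact ⟨_, _, .iteFalse h hr, time_add_le (const_le_time D U (by omega) he) ht, hs⟩

end Ends

/-! ### Running time of loops -/

/-- A loop with `B` iterations. -/
theorem Run.while_counted {b : Test} {p : Program} {B T : ℕ} {I : ℕ → Store → Prop}
    (hstep : ∀ k < B, ∀ s, I k s → b.Holds s ∧ ∃ t s', Run p s t s' ∧ t ≤ T ∧ I (k + 1) s')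
    (hend : ∀ s, I B s → ¬ b.Holds s) (n : ℕ) :
    ∀ k, k + n = B → ∀ s, I k s →
      ∃ t s', Run (.while b p) s t s' ∧ t ≤ n * (b.cost + 1 + T) + (b.cost + 1) ∧ I B s' := by
  induction n with
  | zero =>
    rintro k rfl s hs
    exact ⟨_, _, .whileFalse (hend s hs), by omega, hs⟩
  | succ n ih =>
    intro k hk s hs
    obtain ⟨hb, t, s₁, hr, ht, hs₁⟩ := hstep k (by omega) s hs
    obtain ⟨t', s₂, hr', ht', hs₂⟩ := ih (k + 1) (by omega) s₁ hs₁
    refine ⟨_, _, .whileTrue hb hr hr', ?_, hs₂⟩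
    have : (n + 1) * (b.cost + 1 + T) = n * (b.cost + 1 + T) + (b.cost + 1 + T) := by ring
    omega

/-- The factor `D + 1` is shared between the number of iterations (`X + 1`) and the body (`Y + 1`).
Only `X = 0, Y = D` and `X = D, Y = 0` are used: a loop over coordinates spends the factor on its
iterations, and its body must be free of `D`. This keeps nested loops linear in the dimension. -/
theorem loop_time_le {D U X Y B c T e : ℕ} (hXY : (X + 1) * (Y + 1) = D + 1)
    (hB : B ≤ X * (U + 4) + U) (hc : c ≤ 60) (hT : T ≤ (Y + 1) * (U + 4) ^ e) :
    B * (c + 1 + T) + (c + 1) ≤ (D + 1) * (U + 4) ^ (e + 5) := by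
  have h₁ : c + 1 + T ≤ (Y + 1) * (U + 4) ^ (e + 3) := by
    have := const_le_time Y U (c := 63) (e := 3) (by norm_num) le_rfl
    have h4 : 1 ≤ (U + 4) ^ e := Nat.one_le_pow _ _ (by omega)
    have h5 : 63 + 1 ≤ (U + 4) ^ 3 :=
      (show 63 + 1 ≤ 4 ^ 3 by norm_num).trans (Nat.pow_le_pow_left (by omega) 3)
    have h6 : 1 ≤ (Y + 1) * (U + 4) ^ e := Nat.mul_pos (by omega) h4
    rw [pow_add, ← mul_assoc]
    nlinarith
  have h₂ : B + 1 ≤ (X + 1) * (U + 4) ^ 2 := by nlinarith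
  calc B * (c + 1 + T) + (c + 1) ≤ (B + 1) * (c + 1 + T) := by nlinarith
    _ ≤ ((X + 1) * (U + 4) ^ 2) * ((Y + 1) * (U + 4) ^ (e + 3)) := Nat.mul_le_mul h₂ h₁
    _ = ((X + 1) * (Y + 1)) * (U + 4) ^ (e + 5) := by ring
    _ = _ := by rw [hXY]

theorem Ends.while_counted {D U e B : ℕ} {b : Test} {p : Program} {s : Store}
    (I : ℕ → Store → Prop) (hB : B ≤ U) (h0 : I 0 s)
    (hstep : ∀ k < B, ∀ s', Frame (.while b p) s s' → I k s' →
      b.Holds s' ∧ Ends D U p s' e (I (k + 1)))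
    (hend : ∀ s', Frame (.while b p) s s' → I B s' → ¬ b.Holds s')
    (hc : b.cost ≤ 60 := by decide) :
    Ends D U (.while b p) s (e + 5) (I B) := by
  obtain ⟨t, s', hr, ht, hs⟩ := Run.while_counted (b := b) (p := p) (B := B)
    (T := (D + 1) * (U + 4) ^ e) (I := fun k s' => Frame (.while b p) s s' ∧ I k s') (by
      rintro k hk s' ⟨hf, hs'⟩
      obtain ⟨hb, t, s'', hr, ht, hs''⟩ := hstep k hk s' hf hs'
      exact ⟨hb, t, s'', hr, ht, hf.trans (hr.frame.of_subprogram (fun _ h => h) fun _ h => h),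
        hs''⟩)
    (fun s' h => hend s' h.1 h.2) B 0 (by omega) s ⟨Frame.refl _ _, h0⟩
  exact ⟨t, s', hr, ht.trans (loop_time_le (X := 0) (Y := D) (by ring) (by omega) hc le_rfl), hs.2⟩

/-- The value in cell `0` of an array of natural numbers. -/
abbrev natVar (a : ℕ) : NatExpr := .get a (.lit 0)

/-- The value in cell `0` of an array of real numbers. -/
abbrev realVar (a : ℕ) : RealExpr := .get a (.lit 0)

/-- `for i = 0, …, f - 1 do body`. -/
def forLoop (i : ℕ) (f : NatExpr) (body : Program) : Program :=
  .seq (.setNat i (.lit 0) (.lit 0))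
    (.while (.natLt (natVar i) f)
      (.seq body (.setNat i (.lit 0) (.add (natVar i) (.lit 1)))))

/-- The exponent grows by 2 for incrementing the counter, by 5 for the loop and by 2 for the
initialisation. The invariant must be insensitive to the counter cell, which is rewritten between
iterations. -/
theorem Ends.forLoop_core {D U X Y e B i : ℕ} {f : NatExpr} {body : Program} {s : Store}
    (I : ℕ → Store → Prop) (hXY : (X + 1) * (Y + 1) = D + 1) (hB : B ≤ X * (U + 4) + U)
    (hf : ∀ s', Frame (forLoop i f body) s s' → f.eval s' = B)
    (hI : ∀ k s' v, I k s' → I k (s'.writeNat i 0 v)) (h0 : I 0 s)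
    (hstep : ∀ k < B, ∀ s', Frame (forLoop i f body) s s' → s'.nat i 0 = k → I k s' →
      Ends Y U body s' e (I (k + 1)))
    (hi : body.writesNat i = false) (hc : f.cost ≤ 10) :
    Ends D U (forLoop i f body) s (e + 9) (I B) := by
  set P := forLoop i f body with hP
  set W : Program := .while (.natLt (natVar i) f)
      (.seq body (.setNat i (.lit 0) (.add (natVar i) (.lit 1)))) with hW
  set s₀ := s.writeNat i 0 0
  have hPn : ∀ a, P.writesNat a = false → W.writesNat a = false := by
    intro a; simp [hP, hW, forLoop, Program.writesNat]
  have hPr : ∀ a, P.writesReal a = false → W.writesReal a = false := by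
    intro a; simp [hP, hW, forLoop, Program.writesReal]
  have hs₀ : Frame P s s₀ := (Run.setNat s i (.lit 0) (.lit 0)).frame.of_subprogram (by
      intro a; simp +contextual [hP, forLoop, Program.writesNat])
    (by intro a; simp [Program.writesReal])
  obtain ⟨t, s', hr, ht, hs⟩ := Run.while_counted (b := .natLt (natVar i) f)
    (p := .seq body (.setNat i (.lit 0) (.add (natVar i) (.lit 1)))) (B := B)
    (T := (Y + 1) * (U + 4) ^ (e + 2))
    (I := fun k s' => Frame P s s' ∧ s'.nat i 0 = k ∧ I k s') (by
      rintro k hk s' ⟨hfr, hik, hs'⟩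
      obtain ⟨t, s₁, hr, ht, hs₁⟩ := hstep k hk s' hfr hik hs'
      have hinc : s₁.nat i 0 = k := by rw [hr.frame.nat i hi, hik]
      have hrun := Run.seq hr (Run.setNat s₁ i (.lit 0) (.add (natVar i) (.lit 1)))
      have hrf := hrun.frame
      simp only [NatExpr.eval, hinc] at hrun hrf
      refine ⟨?_, _, _, hrun, ?_, ?_, by simp, hI _ _ _ hs₁⟩
      · simpa [Test.Holds, NatExpr.eval, hf s' hfr, hik] using hk
      · exact time_add_const_le ht (by simp [NatExpr.cost])
      · exact hfr.trans ((hrf.of_subprogram (q := W) (fun _ h => h) fun _ h => h).of_subprogram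
          hPn hPr))
    (by
      rintro s' ⟨hfr, hik, -⟩
      simp [Test.Holds, NatExpr.eval, hf s' hfr, hik]) B 0 (by omega) s₀
    ⟨hs₀, by simp [s₀], hI _ _ _ h0⟩
  refine ⟨_, _, .seq (.setNat s i (.lit 0) (.lit 0)) hr, ?_, hs.2.2⟩
  have h := ht.trans (loop_time_le (D := D) hXY hB (by simp [Test.cost, NatExpr.cost]; omega) le_rfl)
  rw [add_comm]
  exact time_add_const_le h (by simp [NatExpr.cost])

theorem Ends.forLoop {D U e B i : ℕ} {f : NatExpr} {body : Program} {s : Store}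
    (I : ℕ → Store → Prop) (hB : B ≤ U)
    (hf : ∀ s', Frame (forLoop i f body) s s' → f.eval s' = B) (h0 : I 0 s)
    (hstep : ∀ k < B, ∀ s', Frame (RealRAM.forLoop i f body) s s' → s'.nat i 0 = k → I k s' →
      Ends D U body s' e (I (k + 1)))
    (hI : ∀ k s' v, I k s' → I k (s'.writeNat i 0 v) := by exact fun _ _ _ h => h)
    (hi : body.writesNat i = false := by rfl) (hc : f.cost ≤ 10 := by decide) :
    Ends D U (RealRAM.forLoop i f body) s (e + 9) (I B) :=
  forLoop_core (X := 0) (Y := D) I (by ring) (by omega) hf hI h0 hstep hi hc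

/-- A loop over the coordinates, with a body whose running time does not depend on the dimension. -/
theorem Ends.forLoop_dim {D U e i : ℕ} {f : NatExpr} {body : Program} {s : Store}
    (I : ℕ → Store → Prop)
    (hf : ∀ s', Frame (RealRAM.forLoop i f body) s s' → f.eval s' = D) (h0 : I 0 s)
    (hstep : ∀ k < D, ∀ s', Frame (RealRAM.forLoop i f body) s s' → s'.nat i 0 = k → I k s' →
      Ends 0 U body s' e (I (k + 1)))
    (hI : ∀ k s' v, I k s' → I k (s'.writeNat i 0 v) := by exact fun _ _ _ h => h)
    (hi : body.writesNat i = false := by rfl) (hc : f.cost ≤ 10 := by decide) :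
    Ends D U (RealRAM.forLoop i f body) s (e + 9) (I D) :=
  forLoop_core (X := D) (Y := 0) I (by ring) (by nlinarith) hf hI h0 hstep hi hc

/-- Compute a product of two natural numbers by repeated addition. -/
def mulNat (i dst : ℕ) (f g : NatExpr) : Program :=
  .seq (.setNat dst (.lit 0) (.lit 0))
    (forLoop i f (.setNat dst (.lit 0) (.add (natVar dst) g)))

theorem ends_mulNat {D U i dst A B : ℕ} {f g : NatExpr} {s : Store} (hA : A ≤ U) (hne : dst ≠ i)
    (hf : ∀ s', Frame (mulNat i dst f g) s s' → f.eval s' = A)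
    (hg : ∀ s', Frame (mulNat i dst f g) s s' → g.eval s' = B)
    (hcf : f.cost ≤ 10 := by decide) (hcg : g.cost ≤ 10 := by decide) :
    Ends D U (mulNat i dst f g) s 13 (fun s' => s'.nat dst 0 = A * B) := by
  have hframe : ∀ s', Frame (forLoop i f (.setNat dst (.lit 0) (.add (natVar dst) g)))
      (s.writeNat dst 0 0) s' → Frame (mulNat i dst f g) s s' := fun s' h =>
    ((Run.setNat s dst (.lit 0) (.lit 0)).frame.of_subprogram
      (by simp +contextual [mulNat, forLoop, Program.writesNat])
      (by simp +contextual [Program.writesReal])).trans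
    (h.of_subprogram (by simp +contextual [mulNat, Program.writesNat])
      (by simp +contextual [mulNat, Program.writesReal]))
  refine Ends.setNat_seq ?_
  refine (Ends.forLoop (e := 3) (fun k s' => s'.nat dst 0 = k * B) hA
    (fun s' h => hf s' (hframe s' h)) (by simp) ?_ ?_ ?_ hcf).mono
      le_rfl fun _ _ h => h
  · intro k hk s' hfr _ hs'
    refine Ends.setNat ?_ (by simp [NatExpr.cost]; omega) le_rfl
    simp [NatExpr.eval, hs', hg s' (hframe s' hfr)]
    ring
  · intro k s' v h
    simpa [hne] using h
  · simp [Program.writesNat, hne]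

/-- Compute a power of a real number by repeated multiplication. -/
def powReal (i dst base : ℕ) (f : NatExpr) : Program :=
  .seq (.setReal dst (.lit 0) (.ofNat (.lit 1)))
    (forLoop i f (.setReal dst (.lit 0) (.mul (realVar dst) (realVar base))))

theorem ends_powReal {D U i dst base A : ℕ} {b : ℝ} {f : NatExpr} {s : Store} (hA : A ≤ U)
    (hne : base ≠ dst) (hb : s.real base 0 = b)
    (hf : ∀ s', Frame (powReal i dst base f) s s' → f.eval s' = A)
    (hcf : f.cost ≤ 10 := by decide) :
    Ends D U (powReal i dst base f) s 13 (fun s' => s'.real dst 0 = b ^ A) := by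
  have hframe : ∀ s', Frame (forLoop i f (.setReal dst (.lit 0)
      (.mul (realVar dst) (realVar base)))) (s.writeReal dst 0 1) s' →
      Frame (powReal i dst base f) s s' := fun s' h =>
    (show Frame (powReal i dst base f) s (s.writeReal dst 0 1) by
      have := (Run.setReal s dst (.lit 0) (.ofNat (.lit 1))).frame
      simp only [NatExpr.eval, RealExpr.eval, Nat.cast_one] at this
      exact this.of_subprogram (by simp +contextual [Program.writesNat])
        (by simp +contextual [powReal, forLoop, Program.writesReal])).trans
    (h.of_subprogram (by simp +contextual [powReal, Program.writesNat])
      (by simp +contextual [powReal, Program.writesReal]))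
  refine Ends.setReal_seq ?_
  simp only [NatExpr.eval, RealExpr.eval, Nat.cast_one]
  refine (Ends.forLoop (e := 3) (fun k s' => s'.real dst 0 = b ^ k) hA
    (fun s' h => hf s' (hframe s' h)) (by simp) ?_ ?_ ?_ hcf).mono
      le_rfl fun _ _ h => h
  · intro k hk s' hfr _ hs'
    refine Ends.setReal ?_ (by simp [NatExpr.cost, RealExpr.cost]) le_rfl
    have : s'.real base 0 = b := by
      rw [hfr.real base (by simpa [forLoop, Program.writesReal] using hne.symm), ← hb]
      simp [hne]
    simp [NatExpr.eval, RealExpr.eval, hs', this, pow_succ]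
  · exact fun _ _ _ h => h
  · simp [Program.writesNat]

end RealRAM

/-! # The programs

Arrays of natural numbers: `1` the sample size `L`, `2` the number `K * L` of digits, `3` the grid
size `m * (K * L)`, `4` the number of candidates, `5` the current candidate, `6` and `7` remainder
and quotient, `8` the offsets of the sampled points, `9` products, `10`-`15`, `19`, `20` and `22`
loop counters, `16`, `17`, `18` and `23` running offsets, `21` the best candidate.

Arrays of real numbers: `5` an accumulator, `6` the squared distances of a point to the means, `7`
their minimum, `8` and `9` grid roots, `10` their sum, `11` powers, `12` the cost of the current
candidate, `13` the best cost, `14` a base. -/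

namespace RealRAM

/-- Compute the offsets of the points sampled by the current candidate: the base `N` digits of the
number of the candidate, multiplied by the dimension. -/
def digitsProgram : Program :=
  .seq (.setNat 6 (.lit 0) (natVar 5)) <|
  forLoop 11 (natVar 2) <|
    .seq (.setNat 7 (.lit 0) (.lit 0)) <|
    .seq (.while (.not (.natLt (natVar 6) (.get 0 (.lit 0))))
      (.seq (.setNat 6 (.lit 0) (.sub (natVar 6) (.get 0 (.lit 0))))
        (.setNat 7 (.lit 0) (.add (natVar 7) (.lit 1))))) <|
    .seq (mulNat 10 9 (natVar 6) (.get 0 (.lit 1))) <|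
    .seq (.setNat 8 (natVar 11) (natVar 9)) <|
    .setNat 6 (.lit 0) (natVar 7)

/-- Compute the means of the samples. -/
def meansProgram : Program :=
  .seq (.setNat 16 (.lit 0) (.lit 0)) <|
  .seq (.setNat 17 (.lit 0) (.lit 0)) <|
  forLoop 12 (.get 0 (.lit 2)) <|
    .seq (forLoop 13 (.get 0 (.lit 1)) <|
      .seq (.setReal 5 (.lit 0) (.ofNat (.lit 0))) <|
      .seq (forLoop 14 (natVar 1) <|
        .setReal 5 (.lit 0) (.add (realVar 5)
          (.get 1 (.add (.get 8 (.add (natVar 17) (natVar 14))) (natVar 13))))) <|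
      .setReal 3 (.add (natVar 16) (natVar 13)) (.div (realVar 5) (.ofNat (natVar 1)))) <|
    .seq (.setNat 16 (.lit 0) (.add (natVar 16) (.get 0 (.lit 1)))) <|
    .setNat 17 (.lit 0) (.add (natVar 17) (natVar 1))

/-- Compute the squared distances of the current point to the means. -/
def distancesProgram : Program :=
  .seq (.setNat 16 (.lit 0) (.lit 0)) <|
  forLoop 12 (.get 0 (.lit 2)) <|
    .seq (.setReal 5 (.lit 0) (.ofNat (.lit 0))) <|
    .seq (forLoop 13 (.get 0 (.lit 1)) <|
      .setReal 5 (.lit 0) (.add (realVar 5)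
        (.mul (.sub (.get 1 (.add (natVar 23) (natVar 13))) (.get 3 (.add (natVar 16) (natVar 13))))
          (.sub (.get 1 (.add (natVar 23) (natVar 13)))
            (.get 3 (.add (natVar 16) (natVar 13))))))) <|
    .seq (.setReal 6 (natVar 12) (realVar 5)) <|
    .setNat 16 (.lit 0) (.add (natVar 16) (.get 0 (.lit 1)))

/-- Compute the minimum of the squared distances. -/
def minimumProgram : Program :=
  .seq (.setReal 7 (.lit 0) (realVar 6)) <|
  forLoop 12 (.get 0 (.lit 2)) <|
    .ite (.realLt (.get 6 (natVar 12)) (realVar 7))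
      (.setReal 7 (.lit 0) (.get 6 (natVar 12))) .skip

/-- Compute the largest point of the grid whose power, multiplied by the current squared distance,
is at most the minimum of the squared distances. -/
def gridRootProgram : Program :=
  .seq (.setReal 8 (.lit 0) (.ofNat (.lit 0))) <|
  forLoop 20 (natVar 3) <|
    .seq (.setReal 14 (.lit 0)
      (.div (.ofNat (.add (natVar 20) (.lit 1))) (.ofNat (natVar 3)))) <|
    .seq (powReal 19 11 14 (.sub (.get 0 (.lit 3)) (.lit 1))) <|
    .ite (.not (.realLt (realVar 7) (.mul (realVar 11) (.get 6 (natVar 12)))))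
      (.setReal 8 (.lit 0) (realVar 14)) .skip

/-- Compute the grid roots of all means, and their sum. -/
def gridRootsProgram : Program :=
  .seq (.setReal 10 (.lit 0) (.ofNat (.lit 0))) <|
  forLoop 12 (.get 0 (.lit 2)) <|
    .seq gridRootProgram <|
    .seq (.setReal 9 (natVar 12) (realVar 8)) <|
    .setReal 10 (.lit 0) (.add (realVar 10) (realVar 8))

/-- Write the memberships of the current point, and add its cost. -/
def membershipsProgram : Program :=
  forLoop 12 (.get 0 (.lit 2)) <|
    .seq (.setReal 14 (.lit 0) (.div (.get 9 (natVar 12)) (realVar 10))) <|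
    .seq (powReal 19 11 14 (.get 0 (.lit 3))) <|
    .seq (.setReal 4 (.add (natVar 18) (natVar 12)) (realVar 14)) <|
    .setReal 12 (.lit 0) (.add (realVar 12)
      (.mul (.mul (realVar 11) (.get 2 (natVar 15))) (.get 6 (natVar 12))))

/-- Process one point. -/
def pointProgram : Program :=
  .seq distancesProgram <| .seq minimumProgram <| .seq gridRootsProgram membershipsProgram

/-- Compute the memberships of all points, and the cost. -/
def costProgram : Program :=
  .seq (.setReal 12 (.lit 0) (.ofNat (.lit 0))) <|
  .seq (.setNat 23 (.lit 0) (.lit 0)) <|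
  .seq (.setNat 18 (.lit 0) (.lit 0)) <|
  forLoop 15 (.get 0 (.lit 0)) <|
    .seq pointProgram <|
    .seq (.setNat 23 (.lit 0) (.add (natVar 23) (.get 0 (.lit 1)))) <|
    .setNat 18 (.lit 0) (.add (natVar 18) (.get 0 (.lit 2)))

/-- Compute means, memberships and cost of the current candidate. -/
def evaluateProgram : Program :=
  .seq digitsProgram <| .seq meansProgram costProgram

/-- Compute the sample size, the number of digits, the grid size and the number of candidates. -/
def setupProgram : Program :=
  .seq (.while (.realLt (.mul (.ofNat (natVar 1)) (realVar 0)) (.ofNat (.lit 8)))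
    (.setNat 1 (.lit 0) (.add (natVar 1) (.lit 1)))) <|
  .seq (mulNat 10 2 (.get 0 (.lit 2)) (natVar 1)) <|
  .seq (mulNat 10 3 (.get 0 (.lit 3)) (natVar 2)) <|
  .seq (.setNat 4 (.lit 0) (.lit 1)) <|
  forLoop 11 (natVar 2) <|
    .seq (mulNat 10 9 (natVar 4) (.get 0 (.lit 0))) <|
    .setNat 4 (.lit 0) (natVar 9)

/-- Find the best candidate. -/
def searchProgram : Program :=
  .seq (.setNat 5 (.lit 0) (.lit 0)) <|
  .seq evaluateProgram <|
  .seq (.setReal 13 (.lit 0) (realVar 12)) <|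
  .seq (.setNat 21 (.lit 0) (.lit 0)) <|
  forLoop 22 (natVar 4) <|
    .seq (.setNat 5 (.lit 0) (natVar 22)) <|
    .seq evaluateProgram <|
    .ite (.realLt (realVar 12) (realVar 13))
      (.seq (.setReal 13 (.lit 0) (realVar 12)) (.setNat 21 (.lit 0) (natVar 22))) .skip

/-- The exhaustive search for fuzzy `K`-means. -/
def fuzzyProgram : Program :=
  .seq setupProgram <| .seq searchProgram <| .seq (.setNat 5 (.lit 0) (natVar 21)) evaluateProgram

/-! ### Correctness and running time of the subroutines -/

theorem ends_digitsProgram {D U N E T c : ℕ} {s : Store} (hN0 : 1 ≤ N) (hcU : c ≤ U)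
    (hTU : T ≤ U) (hN : s.nat 0 0 = N) (hE : s.nat 0 1 = E) (hT : s.nat 2 0 = T)
    (hc : s.nat 5 0 = c) :
    Ends D U digitsProgram s 40 (fun s' => ∀ j < T, s'.nat 8 j = c / N ^ j % N * E) := by
  refine Ends.setNat_seq ?_
  refine (Ends.forLoop (e := 25) (B := T) (fun j s' => s'.nat 6 0 = c / N ^ j ∧
    ∀ j' < j, s'.nat 8 j' = c / N ^ j' % N * E) hTU (fun s' h => ?_) ?_ ?_).mono (by norm_num)
    fun s' _ h => h.2
  · have := h.nat 2 rfl
    simpa [NatExpr.eval, this] using hT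
  · simp [NatExpr.eval, hc]
  intro j hj s₁ hf hj₁ ⟨hrem, hdig⟩
  have h0 : s₁.nat 0 = s.nat 0 := by simpa using hf.nat 0 rfl
  have hqU : c / N ^ j ≤ U := (Nat.div_le_self _ _).trans hcU
  refine Ends.setNat_seq ?_
  refine Ends.seq (R := fun s' => s'.nat 6 0 = c / N ^ j % N ∧ s'.nat 7 0 = c / N ^ j / N) ?_ ?_
  -- Division with remainder by repeated subtraction: the number of iterations is the quotient,
  -- which is at most `c`, hence at most `U`.
  · refine (Ends.while_counted (e := 4) (B := c / N ^ j / N) (fun k s' =>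
      s'.nat 6 0 = c / N ^ j - k * N ∧ s'.nat 7 0 = k)
      ((Nat.div_le_self _ _).trans hqU) ?_ ?_ ?_).mono (by norm_num) ?_
    · simp [hrem, NatExpr.eval]
    · intro k hk s₂ hf₂ ⟨h6, h7⟩
      have h0' : s₂.nat 0 = s.nat 0 := by rw [← h0]; simpa using hf₂.nat 0 rfl
      refine ⟨?_, Ends.setNat_seq (Ends.setNat ?_)⟩
      · have : (k + 1) * N ≤ c / N ^ j := (Nat.le_div_iff_mul_le (by omega)).1 hk
        simp only [Test.Holds, NatExpr.eval, h6, h0', hN]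
        rw [add_mul] at this
        omega
      · simp [NatExpr.eval, h6, h0', hN, h7, add_mul, Nat.sub_sub]
    · intro s₂ hf₂ ⟨h6, h7⟩
      have h0' : s₂.nat 0 = s.nat 0 := by rw [← h0]; simpa using hf₂.nat 0 rfl
      simp only [Test.Holds, NatExpr.eval, h6, h0', hN, not_not]
      have := Nat.mod_lt (c / N ^ j) (show 0 < N by omega)
      have h2 := Nat.div_add_mod (c / N ^ j) N
      rw [mul_comm] at h2
      omega
    · rintro s₂ - ⟨h6, h7⟩
      refine ⟨?_, h7⟩
      have h2 := Nat.div_add_mod (c / N ^ j) N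
      rw [mul_comm] at h2
      omega
  intro s₂ hf₂ ⟨h6, h7⟩
  have h0₂ : s₂.nat 0 = s.nat 0 := by rw [← h0]; simpa using hf₂.nat 0 rfl
  have h8₂ : s₂.nat 8 = s₁.nat 8 := by simpa using hf₂.nat 8 rfl
  have h11₂ : s₂.nat 11 = s₁.nat 11 := by simpa using hf₂.nat 11 rfl
  refine Ends.seq ((ends_mulNat (A := c / N ^ j % N) (B := E) ?_ (by norm_num) ?_ ?_).mono
    (by norm_num) fun _ _ h => h) ?_
  · exact (Nat.mod_le _ _).trans hqU
  · intro s' h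
    simpa [NatExpr.eval, h.nat 6 rfl] using h6
  · intro s' h
    simpa [NatExpr.eval, h.nat 0 rfl, h0₂] using hE
  intro s₃ hf₃ h9
  have h7₃ : s₃.nat 7 = s₂.nat 7 := hf₃.nat 7 rfl
  have h8₃ : s₃.nat 8 = s₁.nat 8 := (hf₃.nat 8 rfl).trans h8₂
  have h11₃ : s₃.nat 11 = s₁.nat 11 := (hf₃.nat 11 rfl).trans h11₂
  refine Ends.setNat_seq (Ends.setNat ?_)
  refine ⟨by simp [NatExpr.eval, h7₃, h7, Nat.div_div_eq_div_mul, pow_succ], ?_⟩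
  intro j' hj'
  rcases Nat.lt_succ_iff_lt_or_eq.1 hj' with h | rfl
  · rw [← hdig j' h]
    simp only [NatExpr.eval, h11₃, hj₁]
    rw [Store.writeNat_nat_of_ne _ _ _ (by norm_num), Store.writeNat_nat_cell_of_ne _ _ _ (by omega),
      h8₃]
  · simp [NatExpr.eval, h11₃, hj₁, h9]

/-- The coordinates of the means of the samples with the given offsets. -/
def meansCell (E L : ℕ) (X : ℕ → ℝ) (o : ℕ → ℕ) (i : ℕ) : ℝ :=
  (∑ l ∈ Finset.range L, X (o (i / E * L + l) + i % E)) / L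

/-- Arrays 16 and 17 carry `k * E` and `k * L` as running offsets, so that no product has to be
computed inside the loops. -/
theorem ends_meansProgram {E U K L : ℕ} {s : Store} (hE0 : 1 ≤ E) (hKU : K ≤ U) (hLU : L ≤ U)
    (hE : s.nat 0 1 = E) (hK : s.nat 0 2 = K) (hL : s.nat 1 0 = L) :
    Ends E U meansProgram s 50
      (fun s' => ∀ i < K * E, s'.real 3 i = meansCell E L (s.real 1) (s.nat 8) i) := by
  refine Ends.setNat_seq (Ends.setNat_seq ?_)
  refine (Ends.forLoop (e := 35) (B := K) (fun k s' => s'.nat 16 0 = k * E ∧ s'.nat 17 0 = k * L ∧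
    ∀ i < k * E, s'.real 3 i = meansCell E L (s.real 1) (s.nat 8) i) hKU (fun s' h => ?_) ?_ ?_).mono
    (by norm_num) fun s' _ h => h.2.2
  · have := h.nat 0 rfl
    simpa [NatExpr.eval, this] using hK
  · simp [NatExpr.eval]
  intro k hk s₁ hf₁ hk₁ ⟨h16, h17, h3⟩
  have h0₁ : s₁.nat 0 = s.nat 0 := by simpa using hf₁.nat 0 rfl
  have h1₁ : s₁.nat 1 = s.nat 1 := by simpa using hf₁.nat 1 rfl
  have h8₁ : s₁.nat 8 = s.nat 8 := by simpa using hf₁.nat 8 rfl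
  have hX₁ : s₁.real 1 = s.real 1 := by simpa using hf₁.real 1 rfl
  refine Ends.seq (R := fun s' =>
    ∀ i < (k + 1) * E, s'.real 3 i = meansCell E L (s.real 1) (s.nat 8) i) ?_ ?_
  -- Cells are filled consecutively, so one invariant over all cells below `k * E + d` serves both
  -- the inner and the outer loop.
  · refine (Ends.forLoop_dim (e := 20) (fun d s' =>
      ∀ i < k * E + d, s'.real 3 i = meansCell E L (s.real 1) (s.nat 8) i)
      (fun s' h => ?_) h3 ?_).mono (by norm_num) fun s' _ h => ?_
    · have := h.nat 0 rfl
      simpa [NatExpr.eval, this, h0₁] using hE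
    · intro d hd s₂ hf₂ hd₂ h3₂
      refine Ends.setReal_seq ?_
      refine Ends.seq (R := fun s' => s'.real 5 0 =
        ∑ l ∈ Finset.range L, s.real 1 (s.nat 8 (k * L + l) + d)) ?_ ?_
      · refine (Ends.forLoop (e := 3) (B := L) (fun l s' => s'.real 5 0 =
          ∑ l ∈ Finset.range l, s.real 1 (s.nat 8 (k * L + l) + d)) hLU
          (fun s' h => ?_) ?_ ?_).mono (by norm_num) fun s' _ h => h
        · have := h.nat 1 rfl
          simpa [NatExpr.eval, this, hf₂.nat 1 rfl, h1₁] using hL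
        · simp [NatExpr.eval, RealExpr.eval]
        intro l hl s₃ hf₃ hl₃ h5
        refine Ends.setReal ?_
        have h8 : s₃.nat 8 = s.nat 8 := by
          rw [← h8₁, ← hf₂.nat 8 rfl]; simpa using hf₃.nat 8 rfl
        have h17 : s₃.nat 17 0 = k * L := by
          rw [← h17, ← hf₂.nat 17 rfl]; simpa using congrFun (hf₃.nat 17 rfl) 0
        have h13 : s₃.nat 13 0 = d := by
          rw [← hd₂]; simpa using congrFun (hf₃.nat 13 rfl) 0
        have hX : s₃.real 1 = s.real 1 := by
          rw [← hX₁, ← hf₂.real 1 rfl]; simpa using hf₃.real 1 rfl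
        simp [NatExpr.eval, RealExpr.eval, h5, h8, h17, h13, hl₃, hX, Finset.sum_range_succ]
      intro s₃ hf₃ h5
      refine Ends.setReal ?_
      have h16 : s₃.nat 16 0 = k * E := by
        rw [← h16, ← hf₂.nat 16 rfl]; simpa using congrFun (hf₃.nat 16 rfl) 0
      have h13 : s₃.nat 13 0 = d := by
        rw [← hd₂]; simpa using congrFun (hf₃.nat 13 rfl) 0
      have h1 : s₃.nat 1 0 = L := by
        rw [← hL, ← h1₁, ← hf₂.nat 1 rfl]; simpa using congrFun (hf₃.nat 1 rfl) 0
      have h3₃ : s₃.real 3 = s₂.real 3 := by simpa using hf₃.real 3 rfl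
      intro i hi
      simp only [NatExpr.eval, RealExpr.eval, h16, h13, h1, h5]
      rcases Nat.lt_succ_iff_lt_or_eq.1 hi with h | rfl
      · have h' : i < k * E + d := h
        rw [Store.writeReal_real_cell_of_ne _ _ _ (by omega), h3₃, h3₂ i h]
      · have hdiv : (k * E + d) / E = k := by
          rw [mul_comm, Nat.mul_add_div (by omega), Nat.div_eq_of_lt hd, add_zero]
        have hmod : (k * E + d) % E = d := by
          rw [mul_comm, Nat.mul_add_mod, Nat.mod_eq_of_lt hd]
        simp [meansCell, hdiv, hmod]
    · rw [add_mul, one_mul]; exact h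
  intro s₂ hf₂ h3₂
  refine Ends.setNat_seq (Ends.setNat ?_)
  simp [NatExpr.eval, hf₂.nat 16 rfl, h16, hf₂.nat 17 rfl, h17, hf₂.nat 0 rfl, h0₁, hE,
    hf₂.nat 1 rfl, h1₁, hL, add_mul]
  simpa [add_mul] using h3₂


/-- Squared distance of the points with the given offsets in two coordinate arrays. -/
def sqDist (E : ℕ) (X Y : ℕ → ℝ) (i j : ℕ) : ℝ :=
  ∑ d ∈ Finset.range E, (X (i + d) - Y (j + d)) * (X (i + d) - Y (j + d))

theorem sqDist_nonneg (E : ℕ) (X Y : ℕ → ℝ) (i j : ℕ) : 0 ≤ sqDist E X Y i j :=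
  Finset.sum_nonneg fun _ _ => mul_self_nonneg _

theorem ends_distancesProgram {E U K o : ℕ} {s : Store} (hKU : K ≤ U)
    (hE : s.nat 0 1 = E) (hK : s.nat 0 2 = K) (ho : s.nat 23 0 = o) :
    Ends E U distancesProgram s 40
      (fun s' => ∀ k < K, s'.real 6 k = sqDist E (s.real 1) (s.real 3) o (k * E)) := by
  refine Ends.setNat_seq ?_
  refine (Ends.forLoop (e := 25) (B := K) (fun k s' => s'.nat 16 0 = k * E ∧
    ∀ i < k, s'.real 6 i = sqDist E (s.real 1) (s.real 3) o (i * E)) hKU (fun s' h => ?_) ?_ ?_).mono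
    (by norm_num) fun s' _ h => h.2
  · have := h.nat 0 rfl
    simpa [NatExpr.eval, this] using hK
  · simp [NatExpr.eval]
  intro k hk s₁ hf₁ hk₁ ⟨h16, h6⟩
  have h0₁ : s₁.nat 0 = s.nat 0 := by simpa using hf₁.nat 0 rfl
  have h23₁ : s₁.nat 23 = s.nat 23 := by simpa using hf₁.nat 23 rfl
  have h1₁ : s₁.real 1 = s.real 1 := by simpa using hf₁.real 1 rfl
  have h3₁ : s₁.real 3 = s.real 3 := by simpa using hf₁.real 3 rfl
  refine Ends.setReal_seq ?_
  refine Ends.seq (R := fun s' => s'.real 5 0 = sqDist E (s.real 1) (s.real 3) o (k * E)) ?_ ?_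
  · refine (Ends.forLoop_dim (e := 3) (fun d s' => s'.real 5 0 =
      sqDist d (s.real 1) (s.real 3) o (k * E)) (fun s' h => ?_) ?_ ?_).mono (by norm_num)
      fun s' _ h => h
    · have := h.nat 0 rfl
      simpa [NatExpr.eval, this, h0₁] using hE
    · simp [NatExpr.eval, RealExpr.eval, sqDist]
    intro d hd s₂ hf₂ hd₂ h5
    have h1₂ : s₂.real 1 = s.real 1 := by simpa [h1₁] using hf₂.real 1 rfl
    have h3₂ : s₂.real 3 = s.real 3 := by simpa [h3₁] using hf₂.real 3 rfl
    have h23₂ : s₂.nat 23 = s.nat 23 := by simpa [h23₁] using hf₂.nat 23 rfl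
    have h16₂ : s₂.nat 16 = s₁.nat 16 := by simpa using hf₂.nat 16 rfl
    refine Ends.setReal ?_
    simp [NatExpr.eval, RealExpr.eval, h5, h1₂, h3₂, h23₂, h16₂, h16, ho, hd₂, sqDist,
      Finset.sum_range_succ]
  intro s₂ hf₂ h5
  have h6₂ : s₂.real 6 = s₁.real 6 := by simpa using hf₂.real 6 rfl
  have h12₂ : s₂.nat 12 = s₁.nat 12 := by simpa using hf₂.nat 12 rfl
  have h16₂ : s₂.nat 16 = s₁.nat 16 := by simpa using hf₂.nat 16 rfl
  have h0₂ : s₂.nat 0 = s.nat 0 := by simpa [h0₁] using hf₂.nat 0 rfl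
  refine Ends.setReal_seq (Ends.setNat ?_)
  refine ⟨by simp [NatExpr.eval, h16₂, h16, h0₂, hE, add_mul], ?_⟩
  intro i hi
  simp only [NatExpr.eval, RealExpr.eval, h12₂, hk₁, h5, Store.writeNat_real]
  rcases Nat.lt_succ_iff_lt_or_eq.1 hi with h | rfl
  · have h' : i < k := h
    rw [Store.writeReal_real_cell_of_ne _ _ _ (by omega), h6₂, h6 i h']
  · simp

theorem ends_minimumProgram {D U K : ℕ} {s : Store} (hK0 : 1 ≤ K) (hKU : K ≤ U)
    (hK : s.nat 0 2 = K) :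
    Ends D U minimumProgram s 20 (fun s' => (∀ k < K, s'.real 7 0 ≤ s.real 6 k) ∧
      ∃ k < K, s'.real 7 0 = s.real 6 k) := by
  refine Ends.setReal_seq ?_
  refine (Ends.forLoop (e := 4) (B := K) (fun k s' => (∀ i < k, s'.real 7 0 ≤ s.real 6 i) ∧
    ∃ i < K, s'.real 7 0 = s.real 6 i) hKU (fun s' h => ?_) ?_ ?_).mono
    (by norm_num) fun s' _ h => h
  · have := h.nat 0 rfl
    simpa [NatExpr.eval, this] using hK
  · refine ⟨by simp, 0, hK0, by simp [NatExpr.eval, RealExpr.eval]⟩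
  intro k hk s₁ hf₁ hk₁ ⟨hle, hex⟩
  have h6₁ : s₁.real 6 = s.real 6 := by simpa using hf₁.real 6 rfl
  refine Ends.ite (fun hb => Ends.setReal ?_) fun hb => Ends.skip ?_ le_rfl
  all_goals simp only [Test.Holds, NatExpr.eval, RealExpr.eval, hk₁, h6₁, not_lt] at hb
  · simp only [NatExpr.eval, RealExpr.eval, hk₁, h6₁, Store.writeReal_real_self]
    refine ⟨fun i hi => ?_, k, hk, rfl⟩
    rcases Nat.lt_succ_iff_lt_or_eq.1 hi with h | rfl
    · exact hb.le.trans (hle i h)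
    · exact le_rfl
  · refine ⟨fun i hi => ?_, hex⟩
    rcases Nat.lt_succ_iff_lt_or_eq.1 hi with h | rfl
    · exact hle i h
    · exact hb

/-- `y` is the largest number `i / M` with `i ≤ j` and `(i / M) ^ p * a ≤ b`. -/
def IsGridRoot (j M p : ℕ) (a b y : ℝ) : Prop :=
  ∃ i ≤ j, y = (i : ℝ) / M ∧ y ^ p * a ≤ b ∧ ∀ i' ≤ j, ((i' : ℝ) / M) ^ p * a ≤ b → i' ≤ i

theorem ends_gridRootProgram {D U m M k : ℕ} {a b : ℝ} {s : Store} (hm : 2 ≤ m) (hMU : M ≤ U)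
    (hmU : m ≤ U) (hm' : s.nat 0 3 = m) (hM : s.nat 3 0 = M) (hk : s.nat 12 0 = k)
    (ha : s.real 6 k = a) (hb : s.real 7 0 = b) (hb0 : 0 ≤ b) :
    Ends D U gridRootProgram s 35 (fun s' => IsGridRoot M M (m - 1) a b (s'.real 8 0)) := by
  have hp : m - 1 ≠ 0 := by omega
  refine Ends.setReal_seq ?_
  refine (Ends.forLoop (e := 20) (B := M) (fun j s' => IsGridRoot j M (m - 1) a b (s'.real 8 0))
    hMU (fun s' h => ?_) ?_ ?_).mono (by norm_num) fun s' _ h => h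
  · have := h.nat 3 rfl
    simpa [NatExpr.eval, this] using hM
  -- Grid point `0` is always admissible: `m - 1` is positive, so its power vanishes, and `0 ≤ b`.
  · exact ⟨0, le_rfl, by simp [NatExpr.eval, RealExpr.eval],
      by simpa [NatExpr.eval, RealExpr.eval, hp] using hb0, fun i hi _ => hi⟩
  intro j hj s₁ hf₁ hj₁ hroot
  have h0₁ : s₁.nat 0 = s.nat 0 := by simpa using hf₁.nat 0 rfl
  have h3₁ : s₁.nat 3 = s.nat 3 := by simpa using hf₁.nat 3 rfl
  have h12₁ : s₁.nat 12 = s.nat 12 := by simpa using hf₁.nat 12 rfl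
  have h6₁ : s₁.real 6 = s.real 6 := by simpa using hf₁.real 6 rfl
  have h7₁ : s₁.real 7 = s.real 7 := by simpa using hf₁.real 7 rfl
  refine Ends.setReal_seq ?_
  refine Ends.seq ((ends_powReal (A := m - 1) (b := ((j + 1 : ℕ) : ℝ) / M) (by omega)
    (by norm_num) ?_ ?_).mono (by norm_num) fun _ _ h => h) ?_
  · simp [NatExpr.eval, RealExpr.eval, hj₁, h3₁, hM]
  · intro s' h
    simp [NatExpr.eval, h.nat 0 rfl, h0₁, hm']
  intro s₂ hf₂ h11
  have h6₂ : s₂.real 6 = s.real 6 := by simpa [h6₁] using hf₂.real 6 rfl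
  have h7₂ : s₂.real 7 = s.real 7 := by simpa [h7₁] using hf₂.real 7 rfl
  have h8₂ : s₂.real 8 = s₁.real 8 := by simpa using hf₂.real 8 rfl
  have h14₂ : s₂.real 14 0 = ((j + 1 : ℕ) : ℝ) / M := by
    have := congrFun (hf₂.real 14 rfl) 0
    rw [this]
    simp [NatExpr.eval, RealExpr.eval, hj₁, h3₁, hM]
  have h12₂ : s₂.nat 12 = s.nat 12 := by simpa [h12₁] using hf₂.nat 12 rfl
  refine Ends.ite (fun ht => Ends.setReal ?_) fun ht => Ends.skip ?_ (by norm_num)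
  all_goals simp only [Test.Holds, NatExpr.eval, RealExpr.eval, h7₂, hb, h11, h6₂, h12₂, hk, ha,
    not_lt, not_le] at ht
  · simp only [NatExpr.eval, RealExpr.eval, h14₂, Store.writeReal_real_self]
    -- Iteration `j` tests the point `(j + 1) / M`. If it passes, it is the largest index considered
    -- so far, and maximality needs no monotonicity of the power.
    exact ⟨j + 1, le_rfl, rfl, ht, fun i hi _ => hi⟩
  · obtain ⟨i, hij, hy, hya, hmax⟩ := hroot
    rw [h8₂]
    refine ⟨i, by omega, hy, hya, fun i' hi' h => ?_⟩
    rcases Nat.lt_succ_iff_lt_or_eq.1 (Nat.lt_succ_of_le hi') with h' | rfl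
    · exact hmax i' (by omega) h
    · exact absurd h (not_le.2 ht)

theorem ends_gridRootsProgram {D U K m M : ℕ} {b : ℝ} {s : Store} (hm : 2 ≤ m) (hMU : M ≤ U)
    (hmU : m ≤ U) (hKU : K ≤ U) (hK : s.nat 0 2 = K) (hm' : s.nat 0 3 = m) (hM : s.nat 3 0 = M)
    (hb : s.real 7 0 = b) (hb0 : 0 ≤ b) :
    Ends D U gridRootsProgram s 60 (fun s' =>
      (∀ k < K, IsGridRoot M M (m - 1) (s.real 6 k) b (s'.real 9 k)) ∧
      s'.real 10 0 = ∑ k ∈ Finset.range K, s'.real 9 k) := by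
  refine Ends.setReal_seq ?_
  refine (Ends.forLoop (e := 40) (B := K) (fun j s' =>
      (∀ k < j, IsGridRoot M M (m - 1) (s.real 6 k) b (s'.real 9 k)) ∧
      s'.real 10 0 = ∑ k ∈ Finset.range j, s'.real 9 k)
    hKU (fun s' h => ?_) ?_ ?_).mono (by norm_num) fun s' _ h => h
  · have := h.nat 0 rfl
    simpa [NatExpr.eval, this] using hK
  · simp [NatExpr.eval, RealExpr.eval]
  intro k hk s₁ hf₁ hk₁ ⟨hroots, hsum⟩
  have h0₁ : s₁.nat 0 = s.nat 0 := by simpa using hf₁.nat 0 rfl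
  have h3₁ : s₁.nat 3 = s.nat 3 := by simpa using hf₁.nat 3 rfl
  have h6₁ : s₁.real 6 = s.real 6 := by simpa using hf₁.real 6 rfl
  have h7₁ : s₁.real 7 = s.real 7 := by simpa using hf₁.real 7 rfl
  refine Ends.seq ((ends_gridRootProgram (k := k) (a := s.real 6 k) (b := b) hm hMU hmU
    (by rw [h0₁, hm']) (by rw [h3₁, hM]) hk₁ (by rw [h6₁]) (by rw [h7₁, hb]) hb0).mono
    (by norm_num) fun _ _ h => h) ?_
  intro s₂ hf₂ h8
  have h9₂ : s₂.real 9 = s₁.real 9 := by simpa using hf₂.real 9 rfl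
  have h10₂ : s₂.real 10 = s₁.real 10 := by simpa using hf₂.real 10 rfl
  have h12₂ : s₂.nat 12 = s₁.nat 12 := by simpa using hf₂.nat 12 rfl
  refine Ends.setReal_seq (Ends.setReal ?_)
  simp only [NatExpr.eval, RealExpr.eval, h12₂, hk₁]
  have hcell : ∀ i < k, (s₂.writeReal 9 k (s₂.real 8 0)).real 9 i = s₁.real 9 i := by
    intro i hi
    rw [Store.writeReal_real_cell_of_ne _ _ _ (by omega), h9₂]
  refine ⟨fun i hi => ?_, ?_⟩
  · rw [Store.writeReal_real_of_ne _ _ _ (by norm_num)]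
    rcases Nat.lt_succ_iff_lt_or_eq.1 hi with h | rfl
    · rw [hcell i h]
      exact hroots i h
    · rw [Store.writeReal_real_self]
      exact h8
  · rw [Store.writeReal_real_self, Store.writeReal_real_of_ne _ _ _ (by norm_num),
      Store.writeReal_real_of_ne _ _ _ (by norm_num), h10₂, hsum,
      Store.writeReal_real_of_ne _ _ _ (by norm_num), Finset.sum_range_succ,
      Store.writeReal_real_self]
    congr 1
    exact Finset.sum_congr rfl fun i hi => (hcell i (Finset.mem_range.1 hi)).symm

/-- The memberships of all points share array 4, where the frame gives nothing; the first conjunct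
therefore records that those of earlier points survive. -/
theorem ends_membershipsProgram {D U K m o n : ℕ} {s : Store} (hmU : m ≤ U) (hKU : K ≤ U)
    (hK : s.nat 0 2 = K) (hm : s.nat 0 3 = m) (ho : s.nat 18 0 = o) (hn : s.nat 15 0 = n) :
    Ends D U membershipsProgram s 40 (fun s' =>
      (∀ i < o, s'.real 4 i = s.real 4 i) ∧
      (∀ k < K, s'.real 4 (o + k) = s.real 9 k / s.real 10 0) ∧
      s'.real 12 0 = s.real 12 0 +
        ∑ k ∈ Finset.range K, s'.real 4 (o + k) ^ m * s.real 2 n * s.real 6 k) := by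
  refine (Ends.forLoop (e := 20) (B := K) (fun j s' =>
      (∀ i < o, s'.real 4 i = s.real 4 i) ∧
      (∀ k < j, s'.real 4 (o + k) = s.real 9 k / s.real 10 0) ∧
      s'.real 12 0 = s.real 12 0 +
        ∑ k ∈ Finset.range j, s'.real 4 (o + k) ^ m * s.real 2 n * s.real 6 k)
    hKU (fun s' h => ?_) ?_ ?_).mono (by norm_num) fun s' _ h => h
  · have := h.nat 0 rfl
    simpa [NatExpr.eval, this] using hK
  · simp
  intro k hk s₁ hf₁ hk₁ ⟨hold, hnew, hsum⟩
  have h0₁ : s₁.nat 0 = s.nat 0 := hf₁.nat 0 rfl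
  have h15₁ : s₁.nat 15 = s.nat 15 := hf₁.nat 15 rfl
  have h18₁ : s₁.nat 18 = s.nat 18 := hf₁.nat 18 rfl
  have h2₁ : s₁.real 2 = s.real 2 := hf₁.real 2 rfl
  have h6₁ : s₁.real 6 = s.real 6 := hf₁.real 6 rfl
  have h9₁ : s₁.real 9 = s.real 9 := hf₁.real 9 rfl
  have h10₁ : s₁.real 10 = s.real 10 := hf₁.real 10 rfl
  refine Ends.setReal_seq ?_
  refine Ends.seq ((ends_powReal (A := m) (b := s.real 9 k / s.real 10 0) hmU
    (by norm_num) ?_ ?_).mono (by norm_num) fun _ _ h => h) ?_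
  · simp [NatExpr.eval, RealExpr.eval, hk₁, h9₁, h10₁]
  · intro s' h
    simp [NatExpr.eval, h.nat 0 rfl, h0₁, hm]
  intro s₂ hf₂ h11
  have h14₂ : s₂.real 14 0 = s.real 9 k / s.real 10 0 := by
    have := congrFun (hf₂.real 14 rfl) 0
    rw [this]
    simp [NatExpr.eval, RealExpr.eval, hk₁, h9₁, h10₁]
  have h2₂ : s₂.real 2 = s.real 2 := by simpa [h2₁] using hf₂.real 2 rfl
  have h6₂ : s₂.real 6 = s.real 6 := by simpa [h6₁] using hf₂.real 6 rfl
  have h4₂ : s₂.real 4 = s₁.real 4 := by simpa using hf₂.real 4 rfl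
  have h12r : s₂.real 12 = s₁.real 12 := by simpa using hf₂.real 12 rfl
  have h12₂ : s₂.nat 12 0 = k := by rw [← hk₁]; simpa using congrFun (hf₂.nat 12 rfl) 0
  have h15₂ : s₂.nat 15 0 = n := by
    rw [← hn, ← h15₁]; simpa using congrFun (hf₂.nat 15 rfl) 0
  have h18₂ : s₂.nat 18 0 = o := by
    rw [← ho, ← h18₁]; simpa using congrFun (hf₂.nat 18 rfl) 0
  refine Ends.setReal_seq (Ends.setReal ?_)
  simp only [NatExpr.eval, RealExpr.eval, h12₂, h18₂, h14₂]
  set v := s.real 9 k / s.real 10 0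
  have hcell : ∀ i < o + k, (s₂.writeReal 4 (o + k) v).real 4 i = s₁.real 4 i := by
    intro i hi
    rw [Store.writeReal_real_cell_of_ne _ _ _ (by omega), h4₂]
  refine ⟨fun i hi => ?_, fun i hi => ?_, ?_⟩
  · rw [Store.writeReal_real_of_ne _ _ _ (by norm_num), hcell i (by omega), hold i hi]
  · rw [Store.writeReal_real_of_ne _ _ _ (by norm_num)]
    rcases Nat.lt_succ_iff_lt_or_eq.1 hi with h | rfl
    · have h' : i < k := h
      rw [hcell _ (by omega)]
      exact hnew i h
    · rw [Store.writeReal_real_self]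
  · rw [Store.writeReal_real_self, Store.writeReal_real_of_ne _ _ _ (by norm_num), h12r, hsum,
      Finset.sum_range_succ, add_assoc]
    simp only [Store.writeReal_real_of_ne _ _ _ (show (4 : ℕ) ≠ 12 by norm_num),
      Store.writeReal_real_of_ne _ _ _ (show (2 : ℕ) ≠ 4 by norm_num),
      Store.writeReal_real_of_ne _ _ _ (show (6 : ℕ) ≠ 4 by norm_num),
      Store.writeReal_real_of_ne _ _ _ (show (11 : ℕ) ≠ 4 by norm_num),
      Store.writeReal_real_self, Store.writeReal_nat, h2₂, h6₂, h11, h12₂, h15₂]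
    congr 2
    exact Finset.sum_congr rfl fun i hi => by
      rw [hcell _ (by have := Finset.mem_range.1 hi; omega)]

end RealRAM

/-! ### Near-optimal memberships without roots -/

/-- The memberships `r` of one point with squared distances `a k` to the means are optimal up to the
factor `ρ`. -/
def NearOptimal (K m : ℕ) (ρ : ℝ) (a r : ℕ → ℝ) : Prop :=
  (∀ k < K, 0 ≤ r k) ∧ ∑ k ∈ Finset.range K, r k = 1 ∧
    ∀ q : ℕ → ℝ, (∀ k < K, 0 ≤ q k) → ∑ k ∈ Finset.range K, q k = 1 →
      ∑ k ∈ Finset.range K, r k ^ m * a k ≤ ρ * ∑ k ∈ Finset.range K, q k ^ m * a k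

theorem NearOptimal.congr {K m : ℕ} {ρ : ℝ} {a a' r r' : ℕ → ℝ} (h : NearOptimal K m ρ a r)
    (ha : ∀ k < K, a' k = a k) (hr : ∀ k < K, r' k = r k) : NearOptimal K m ρ a' r' := by
  obtain ⟨h0, h1, h2⟩ := h
  refine ⟨fun k hk => by rw [hr k hk]; exact h0 k hk, ?_, fun q hq hq1 => ?_⟩
  · rw [← h1]
    exact Finset.sum_congr rfl fun k hk => hr k (Finset.mem_range.1 hk)
  · have e1 : ∑ k ∈ Finset.range K, r' k ^ m * a' k = ∑ k ∈ Finset.range K, r k ^ m * a k :=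
      Finset.sum_congr rfl fun k hk => by
        rw [hr k (Finset.mem_range.1 hk), ha k (Finset.mem_range.1 hk)]
    have e2 : ∑ k ∈ Finset.range K, q k ^ m * a' k = ∑ k ∈ Finset.range K, q k ^ m * a k :=
      Finset.sum_congr rfl fun k hk => by rw [ha k (Finset.mem_range.1 hk)]
    rw [e1, e2]
    exact h2 q hq hq1

/-- A case of Radon's inequality. -/
theorem inv_sum_pow_le_sum_pow_div {ι : Type*} (s : Finset ι) (p : ℕ) {q z : ι → ℝ}
    (hs : s.Nonempty) (hq : ∀ i ∈ s, 0 ≤ q i) (hz : ∀ i ∈ s, 0 < z i) (hq1 : ∑ i ∈ s, q i = 1) :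
    ((∑ i ∈ s, z i) ^ p)⁻¹ ≤ ∑ i ∈ s, q i ^ (p + 1) / z i ^ p := by
  set Z := ∑ i ∈ s, z i with hZ
  have hZ0 : 0 < Z := Finset.sum_pos hz hs
  -- Convexity of the power `p + 1`, with weights `z i / Z` at the values `q i / z i`, whose
  -- weighted mean is `Z⁻¹`.
  have h := Real.pow_arith_mean_le_arith_mean_pow s (fun i => z i / Z) (fun i => q i / z i)
    (fun i hi => (div_pos (hz i hi) hZ0).le) (by rw [← Finset.sum_div, div_self hZ0.ne'])
    (fun i hi => div_nonneg (hq i hi) (hz i hi).le) (p + 1)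
  have e1 : ∑ i ∈ s, z i / Z * (q i / z i) = Z⁻¹ := by
    rw [← one_mul Z⁻¹, ← hq1, Finset.sum_mul]
    refine Finset.sum_congr rfl fun i hi => ?_
    have := (hz i hi).ne'
    field_simp
  have e2 : ∑ i ∈ s, z i / Z * (q i / z i) ^ (p + 1) = Z⁻¹ * ∑ i ∈ s, q i ^ (p + 1) / z i ^ p := by
    rw [Finset.mul_sum]
    refine Finset.sum_congr rfl fun i hi => ?_
    have := (hz i hi).ne'
    rw [div_pow, pow_succ (z i)]
    field_simp
  simp only [e1, e2] at h
  rw [pow_succ, mul_comm] at h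
  rw [← inv_pow]
  exact le_of_mul_le_mul_left h (inv_pos.2 hZ0)

/-- Passing through `1 + t ≤ exp t` and `exp u ≤ 1 / (1 - u)` turns the power into a rational
function of `L`, independent of `m`. The strict bound `1 / L < 1` is why `2 ≤ L` is required. -/
theorem one_add_pow_le_inv {p m L : ℕ} (hp : p ≤ m) (hm : 0 < m) (hL : 2 ≤ L) :
    (1 + 1 / ((m : ℝ) * L)) ^ p ≤ (1 - 1 / (L : ℝ))⁻¹ := by
  have hL' : (2 : ℝ) ≤ L := by exact_mod_cast hL
  have hm' : (0 : ℝ) < m := by exact_mod_cast hm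
  have h0 : (0 : ℝ) ≤ 1 / (m * L) := by positivity
  have hL1 : 1 / (L : ℝ) < 1 := by rw [div_lt_one (by linarith)]; linarith
  calc (1 + 1 / ((m : ℝ) * L)) ^ p ≤ (1 + 1 / ((m : ℝ) * L)) ^ m :=
        pow_le_pow_right₀ (by linarith) hp
    _ ≤ Real.exp (1 / (m * L)) ^ m :=
        pow_le_pow_left₀ (by linarith) (by linarith [Real.add_one_le_exp (1 / ((m : ℝ) * L))]) _
    _ = Real.exp (1 / L) := by
        rw [← Real.exp_nat_mul]
        congr 1
        field_simp
    _ ≤ (1 - 1 / (L : ℝ))⁻¹ := by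
        rw [← one_div]
        exact Real.exp_bound_div_one_sub_of_interval (by positivity) hL1

open RealRAM in
/-- Grid roots yield memberships which are optimal up to a constant factor. -/
theorem nearOptimal_gridRoots {K m L M : ℕ} (hm : 2 ≤ m) (hL : 2 ≤ L)
    (hM : M = m * (K * L)) {a y : ℕ → ℝ} {b : ℝ} (hb : 0 ≤ b) (ha : ∀ k < K, b ≤ a k)
    (hex : ∃ k < K, b = a k) (hy : ∀ k < K, IsGridRoot M M (m - 1) (a k) b (y k)) :
    NearOptimal K m (1 - 1 / (L : ℝ))⁻¹ a (fun k => y k / ∑ k ∈ Finset.range K, y k) := by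
  obtain ⟨k₀, hk₀, hbk₀⟩ := hex
  have hK : 0 < K := by omega
  obtain ⟨p, rfl⟩ : ∃ p, m = p + 1 := ⟨m - 1, by omega⟩
  simp only [Nat.add_sub_cancel] at hy
  have hMpos : 0 < M := by rw [hM]; positivity
  have hM0 : (0 : ℝ) < M := by exact_mod_cast hMpos
  have hy0 : ∀ k < K, 0 ≤ y k := by
    intro k hk
    obtain ⟨i, -, h, -⟩ := hy k hk
    rw [h]; positivity
  have hya : ∀ k < K, y k ^ p * a k ≤ b := fun k hk => (hy k hk).choose_spec.2.2.1
  -- The nearest mean gets the top grid point. Hence the sum `S` of the roots is at least `1`, and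
  -- an absolute rounding error becomes a relative one.
  have hyk₀ : y k₀ = 1 := by
    obtain ⟨i, hi, h, -, hmax⟩ := hy k₀ hk₀
    have := hmax M le_rfl (by rw [div_self hM0.ne', one_pow, one_mul, hbk₀])
    rw [h, show i = M by omega, div_self hM0.ne']
  set S := ∑ k ∈ Finset.range K, y k with hS
  have hS1 : 1 ≤ S := by
    rw [← hyk₀]
    exact Finset.single_le_sum (fun k hk => hy0 k (Finset.mem_range.1 hk)) (Finset.mem_range.2 hk₀)
  have hS0 : 0 < S := by linarith
  refine ⟨fun k hk => div_nonneg (hy0 k hk) hS0.le,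
    by rw [← Finset.sum_div, div_self hS0.ne'], fun q hq hq1 => ?_⟩
  have hupper : ∑ k ∈ Finset.range K, (y k / S) ^ (p + 1) * a k ≤ b * (S ^ p)⁻¹ := by
    calc ∑ k ∈ Finset.range K, (y k / S) ^ (p + 1) * a k
        = ∑ k ∈ Finset.range K, (y k * (y k ^ p * a k)) * (S ^ (p + 1))⁻¹ :=
          Finset.sum_congr rfl fun k _ => by rw [div_pow]; ring
      _ ≤ ∑ k ∈ Finset.range K, (y k * b) * (S ^ (p + 1))⁻¹ := by
          refine Finset.sum_le_sum fun k hk => ?_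
          have hk := Finset.mem_range.1 hk
          have := hya k hk
          have := hy0 k hk
          gcongr
      _ = b * (S ^ p)⁻¹ := by
          rw [← Finset.sum_mul, ← Finset.sum_mul, ← hS, pow_succ]
          field_simp
  -- The next grid point. Where `y k` satisfies `y k ^ p * a k ≤ b`, the point `z k` satisfies the
  -- reverse inequality: by maximality of `y k`, or, beyond the end of the grid, because `z k ≥ 1`
  -- and `a k ≥ b`.
  set z : ℕ → ℝ := fun k => y k + 1 / M with hz
  have hz0 : ∀ k < K, 0 < z k := fun k hk => by have := hy0 k hk; positivity
  have hza : ∀ k < K, b ≤ z k ^ p * a k := by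
    intro k hk
    obtain ⟨i, hi, h, -, hmax⟩ := hy k hk
    have hak : 0 ≤ a k := hb.trans (ha k hk)
    have hzi : z k = ((i + 1 : ℕ) : ℝ) / M := by
      simp only [hz, h]; push_cast; ring
    rcases Nat.lt_or_ge i M with hlt | hge
    · by_contra! hcon
      have := hmax (i + 1) (by omega) (by rw [← hzi]; exact hcon.le)
      omega
    · have : 1 ≤ z k := by
        rw [hzi, le_div_iff₀ hM0, one_mul]
        exact_mod_cast (by omega : M ≤ i + 1)
      calc b ≤ 1 * a k := by simpa using ha k hk
        _ ≤ z k ^ p * a k := mul_le_mul_of_nonneg_right (one_le_pow₀ this) hak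
  -- The `K` rounding errors add up to `K / M = 1 / (m * L)`, which is at most that multiple of `S`
  -- since `1 ≤ S`.
  have hZS : ∑ k ∈ Finset.range K, z k ≤ S * (1 + 1 / (((p + 1 : ℕ) : ℝ) * L)) := by
    have hKM : (K : ℝ) * (1 / M) = 1 / (((p + 1 : ℕ) : ℝ) * L) := by
      have : (0 : ℝ) < K := by exact_mod_cast hK
      rw [hM]; push_cast; field_simp
    simp only [hz, Finset.sum_add_distrib, Finset.sum_const, Finset.card_range, nsmul_eq_mul,
      hKM, ← hS]
    have : 0 ≤ 1 / (((p + 1 : ℕ) : ℝ) * L) := by positivity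
    nlinarith
  set Z := ∑ k ∈ Finset.range K, z k with hZ
  have hne : (Finset.range K).Nonempty := ⟨k₀, Finset.mem_range.2 hk₀⟩
  have hZ0 : 0 < Z := Finset.sum_pos (fun k hk => hz0 k (Finset.mem_range.1 hk)) hne
  -- Radon's inequality bounds the cost of arbitrary memberships `q` from below, after `a k` has
  -- been replaced by `b / z k ^ p`.
  have hlower : b * (Z ^ p)⁻¹ ≤ ∑ k ∈ Finset.range K, q k ^ (p + 1) * a k := by
    calc b * (Z ^ p)⁻¹ ≤ b * ∑ k ∈ Finset.range K, q k ^ (p + 1) / z k ^ p :=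
          mul_le_mul_of_nonneg_left (inv_sum_pow_le_sum_pow_div _ p hne
            (fun k hk => hq k (Finset.mem_range.1 hk))
            (fun k hk => hz0 k (Finset.mem_range.1 hk)) hq1) hb
      _ = ∑ k ∈ Finset.range K, q k ^ (p + 1) / z k ^ p * b := by
          rw [Finset.mul_sum]; exact Finset.sum_congr rfl fun _ _ => mul_comm _ _
      _ ≤ ∑ k ∈ Finset.range K, q k ^ (p + 1) * a k := by
          refine Finset.sum_le_sum fun k hk => ?_
          have hk := Finset.mem_range.1 hk
          have h1 := hz0 k hk
          have h2 := hq k hk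
          calc q k ^ (p + 1) / z k ^ p * b ≤ q k ^ (p + 1) / z k ^ p * (z k ^ p * a k) :=
                mul_le_mul_of_nonneg_left (hza k hk) (by positivity)
            _ = q k ^ (p + 1) * a k := by field_simp
  have hρ := one_add_pow_le_inv (p := p) (m := p + 1) (by omega) (by omega) hL
  have hρ0 : 0 ≤ (1 - 1 / (L : ℝ))⁻¹ := le_trans (by positivity) hρ
  have hZp : Z ^ p ≤ (1 - 1 / (L : ℝ))⁻¹ * S ^ p := by
    calc Z ^ p ≤ (S * (1 + 1 / (((p + 1 : ℕ) : ℝ) * L))) ^ p := pow_le_pow_left₀ hZ0.le hZS p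
      _ = S ^ p * (1 + 1 / (((p + 1 : ℕ) : ℝ) * L)) ^ p := mul_pow _ _ _
      _ ≤ S ^ p * (1 - 1 / (L : ℝ))⁻¹ := mul_le_mul_of_nonneg_left hρ (by positivity)
      _ = _ := mul_comm _ _
  have hSZ : (S ^ p)⁻¹ ≤ (1 - 1 / (L : ℝ))⁻¹ * (Z ^ p)⁻¹ := by
    rw [← div_eq_mul_inv, le_div_iff₀ (by positivity), inv_mul_le_iff₀ (by positivity)]
    linarith
  calc _ ≤ b * (S ^ p)⁻¹ := hupper
    _ ≤ b * ((1 - 1 / (L : ℝ))⁻¹ * (Z ^ p)⁻¹) := mul_le_mul_of_nonneg_left hSZ hb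
    _ = (1 - 1 / (L : ℝ))⁻¹ * (b * (Z ^ p)⁻¹) := by ring
    _ ≤ _ := mul_le_mul_of_nonneg_left hlower hρ0

/-! ### Sample means -/

/-- The mean of a suitable sample of size `L` is close to the weighted mean. -/
theorem exists_sample_sum_close {V : Type*} [NormedAddCommGroup V] [InnerProductSpace ℝ V]
    {ι : Type*} [Fintype ι] (p : ι → ℝ) (hp : ∀ i, 0 ≤ p i) (hp1 : ∑ i, p i = 1) (x : ι → V) (L : ℕ) :
    ∃ σ : ℕ → ι, ‖∑ l ∈ Finset.range L, (x (σ l) - ∑ i, p i • x i)‖ ^ 2 ≤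
      L * ∑ i, p i * ‖x i - ∑ j, p j • x j‖ ^ 2 := by
  classical
  set c := ∑ i, p i • x i with hc
  have hne : Nonempty ι := by
    by_contra h
    rw [not_nonempty_iff] at h
    simp at hp1
  induction L with
  | zero => exact ⟨fun _ => hne.some, by simp⟩
  | succ L ih =>
    obtain ⟨σ, hσ⟩ := ih
    set S := ∑ l ∈ Finset.range L, (x (σ l) - c) with hS
    set T := ∑ i, p i * ‖x i - c‖ ^ 2 with hT
    have hcenter : ∑ i, p i • (x i - c) = 0 := by
      simp only [smul_sub, Finset.sum_sub_distrib, ← Finset.sum_smul, hp1, one_smul, ← hc, sub_self]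
    -- Averaging over the next sample point: the cross term vanishes because the deviations from `c`
    -- have mean zero. Some choice is no worse than the average, so the sample is extended greedily
    -- and no product measure is needed.
    have hmean : ∑ i, p i * ‖S + (x i - c)‖ ^ 2 = ‖S‖ ^ 2 + T := by
      have : ∀ i, p i * ‖S + (x i - c)‖ ^ 2 =
          p i * ‖S‖ ^ 2 + 2 * inner ℝ S (p i • (x i - c)) + p i * ‖x i - c‖ ^ 2 := by
        intro i
        rw [norm_add_sq_real, real_inner_smul_right]; ring
      simp only [this, Finset.sum_add_distrib, ← Finset.sum_mul, hp1, one_mul, ← Finset.mul_sum,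
        ← inner_sum, hcenter, inner_zero_right, mul_zero, add_zero, hT]
    obtain ⟨i, hi⟩ : ∃ i, ‖S + (x i - c)‖ ^ 2 ≤ ‖S‖ ^ 2 + T := by
      by_contra! hcon
      have h1 : ∑ i, p i * (‖S‖ ^ 2 + T) < ∑ i, p i * ‖S + (x i - c)‖ ^ 2 := by
        refine Finset.sum_lt_sum (fun i _ => mul_le_mul_of_nonneg_left (hcon i).le (hp i)) ?_
        by_contra! h
        have : ∀ i, p i = 0 := fun i => by
          have := h i (Finset.mem_univ i)
          by_contra hpi
          have hpos := lt_of_le_of_ne (hp i) (Ne.symm hpi)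
          exact absurd this (not_le.2 (mul_lt_mul_of_pos_left (hcon i) hpos))
        simp [this] at hp1
      rw [← Finset.sum_mul, hp1, one_mul, hmean] at h1
      exact lt_irrefl _ h1
    refine ⟨Function.update σ L i, ?_⟩
    have e : ∑ l ∈ Finset.range L, (x (Function.update σ L i l) - c) = S :=
      Finset.sum_congr rfl fun l hl => by
        rw [Function.update_of_ne (Finset.mem_range.1 hl).ne]
    rw [Finset.sum_range_succ, e, Function.update_self]
    push_cast
    linarith

/-- For nonnegative weights, the mean of a suitable sample of size `L` is optimal up to the factor
`1 + 1 / L`. -/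
theorem exists_sample_mean_cost_le {V : Type*} [NormedAddCommGroup V] [InnerProductSpace ℝ V]
    {ι : Type*} [Fintype ι] [Nonempty ι] (v : ι → ℝ) (hv : ∀ i, 0 ≤ v i) (x : ι → V) (μ : V) {L : ℕ}
    (hL : 0 < L) :
    ∃ σ : ℕ → ι, ∑ i, v i * ‖x i - (L : ℝ)⁻¹ • ∑ l ∈ Finset.range L, x (σ l)‖ ^ 2 ≤
      (1 + 1 / (L : ℝ)) * ∑ i, v i * ‖x i - μ‖ ^ 2 := by
  have hL' : (0 : ℝ) < L := by exact_mod_cast hL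
  -- If the total weight is zero it cannot be normalised, but then all weights vanish and every
  -- sample works.
  rcases (Finset.sum_nonneg fun i (_ : i ∈ Finset.univ) => hv i).eq_or_lt with h0 | hpos
  · have hz : ∀ i, v i = 0 := fun i =>
      (Finset.sum_eq_zero_iff_of_nonneg fun i _ => hv i).1 h0.symm i (Finset.mem_univ i)
    exact ⟨fun _ => Classical.arbitrary ι, by simp [hz]⟩
  set W := ∑ i, v i with hW
  obtain ⟨σ, hσ⟩ := exists_sample_sum_close (fun i => v i / W) (fun i => div_nonneg (hv i) hpos.le)
    (by rw [← Finset.sum_div, div_self hpos.ne']) x L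
  refine ⟨σ, ?_⟩
  set c := ∑ i, (v i / W) • x i with hc
  have hcenter : ∑ i, v i • (x i - c) = 0 := by
    have : W • c = ∑ i, v i • x i := by
      rw [hc, Finset.smul_sum]
      refine Finset.sum_congr rfl fun i _ => ?_
      rw [smul_smul, mul_div_cancel₀ _ hpos.ne']
    simp only [smul_sub, Finset.sum_sub_distrib, ← Finset.sum_smul, ← hW, this, sub_self]
  -- The parallel axis theorem: the cost at `u` exceeds the cost at the centroid `c` by the total
  -- weight times `‖c - u‖ ^ 2`. It is used for the sample mean and for `μ`.
  have hshift : ∀ u : V, ∑ i, v i * ‖x i - u‖ ^ 2 = ∑ i, v i * ‖x i - c‖ ^ 2 + W * ‖c - u‖ ^ 2 := by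
    intro u
    have : ∀ i, v i * ‖x i - u‖ ^ 2 =
        v i * ‖x i - c‖ ^ 2 + 2 * inner ℝ (v i • (x i - c)) (c - u) + v i * ‖c - u‖ ^ 2 := by
      intro i
      rw [show x i - u = (x i - c) + (c - u) by abel, norm_add_sq_real, real_inner_smul_left]; ring
    simp only [this, Finset.sum_add_distrib, ← Finset.sum_mul, ← Finset.mul_sum, ← sum_inner,
      hcenter, inner_zero_left, mul_zero, add_zero, ← hW]
  set T := ∑ i, v i * ‖x i - c‖ ^ 2 with hT
  have hclose : W * ‖c - (L : ℝ)⁻¹ • ∑ l ∈ Finset.range L, x (σ l)‖ ^ 2 ≤ 1 / L * T := by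
    have e1 : c - (L : ℝ)⁻¹ • ∑ l ∈ Finset.range L, x (σ l) =
        -((L : ℝ)⁻¹ • ∑ l ∈ Finset.range L, (x (σ l) - c)) := by
      rw [Finset.sum_sub_distrib, smul_sub, Finset.sum_const, Finset.card_range,
        ← Nat.cast_smul_eq_nsmul ℝ, smul_smul, inv_mul_cancel₀ hL'.ne', one_smul, neg_sub]
    have e2 : W * ∑ i, v i / W * ‖x i - c‖ ^ 2 = T := by
      rw [Finset.mul_sum]
      refine Finset.sum_congr rfl fun i _ => ?_
      rw [← mul_assoc, mul_div_cancel₀ _ hpos.ne']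
    rw [e1, norm_neg, norm_smul, mul_pow, Real.norm_eq_abs, sq_abs]
    calc W * ((L : ℝ)⁻¹ ^ 2 * ‖∑ l ∈ Finset.range L, (x (σ l) - c)‖ ^ 2)
        ≤ W * ((L : ℝ)⁻¹ ^ 2 * (L * ∑ i, v i / W * ‖x i - c‖ ^ 2)) := by gcongr
      _ = (L : ℝ)⁻¹ ^ 2 * L * (W * ∑ i, v i / W * ‖x i - c‖ ^ 2) := by ring
      _ = 1 / L * T := by rw [e2]; field_simp
  have hμ : T ≤ ∑ i, v i * ‖x i - μ‖ ^ 2 := by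
    rw [hshift μ]
    nlinarith [sq_nonneg ‖c - μ‖]
  rw [hshift]
  calc _ ≤ T + 1 / L * T := by linarith
    _ = (1 + 1 / (L : ℝ)) * T := by ring
    _ ≤ _ := mul_le_mul_of_nonneg_left hμ (by positivity)

/-! ### Evaluation of one candidate -/

namespace RealRAM

theorem ends_pointProgram {E U K m L n o o' : ℕ} {s : Store} (hK0 : 1 ≤ K) (hm : 2 ≤ m) (hL : 2 ≤ L)
    (hKU : K ≤ U) (hmU : m ≤ U) (hMU : m * (K * L) ≤ U) (hE : s.nat 0 1 = E) (hK : s.nat 0 2 = K)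
    (hm' : s.nat 0 3 = m) (hM : s.nat 3 0 = m * (K * L)) (hn : s.nat 15 0 = n)
    (ho : s.nat 23 0 = o) (ho' : s.nat 18 0 = o') :
    Ends E U pointProgram s 70 (fun s' =>
      (∀ i < o', s'.real 4 i = s.real 4 i) ∧
      NearOptimal K m (1 - 1 / (L : ℝ))⁻¹ (fun k => sqDist E (s.real 1) (s.real 3) o (k * E))
        (fun k => s'.real 4 (o' + k)) ∧
      s'.real 12 0 = s.real 12 0 + ∑ k ∈ Finset.range K,
        s'.real 4 (o' + k) ^ m * s.real 2 n * sqDist E (s.real 1) (s.real 3) o (k * E)) := by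
  refine Ends.seq ((ends_distancesProgram hKU hE hK ho).mono (by norm_num) fun _ _ h => h)
    fun s₁ hf₁ h6 => ?_
  have h0₁ : s₁.nat 0 = s.nat 0 := hf₁.nat 0 rfl
  refine Ends.seq ((ends_minimumProgram (K := K) hK0 hKU (by rw [h0₁, hK])).mono (by norm_num)
    fun _ _ h => h) fun s₂ hf₂ ⟨hle, hex⟩ => ?_
  have h0₂ : s₂.nat 0 = s.nat 0 := (hf₂.nat 0 rfl).trans h0₁
  have h3₂ : s₂.nat 3 = s.nat 3 := (hf₂.nat 3 rfl).trans (hf₁.nat 3 rfl)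
  have h6₂ : s₂.real 6 = s₁.real 6 := hf₂.real 6 rfl
  have hb0 : 0 ≤ s₂.real 7 0 := by
    obtain ⟨k, hk, h⟩ := hex
    rw [h, h6 k hk]
    exact sqDist_nonneg _ _ _ _ _
  refine Ends.seq ((ends_gridRootsProgram hm hMU hmU hKU (by rw [h0₂, hK]) (by rw [h0₂, hm'])
    (by rw [h3₂, hM]) rfl hb0).mono (by norm_num) fun _ _ h => h) fun s₃ hf₃ ⟨hroots, hsum⟩ => ?_
  have h0₃ : s₃.nat 0 = s.nat 0 := (hf₃.nat 0 rfl).trans h0₂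
  refine (ends_membershipsProgram (o := o') (n := n) hmU hKU (by rw [h0₃, hK]) (by rw [h0₃, hm'])
    (by rw [hf₃.nat 18 rfl, hf₂.nat 18 rfl, hf₁.nat 18 rfl, ho'])
    (by rw [hf₃.nat 15 rfl, hf₂.nat 15 rfl, hf₁.nat 15 rfl, hn])).mono (by norm_num) ?_
  rintro s₄ - ⟨hold, hnew, hcost⟩
  have h6₃ : ∀ k < K, s₃.real 6 k = sqDist E (s.real 1) (s.real 3) o (k * E) := fun k hk => by
    rw [hf₃.real 6 rfl, h6₂, h6 k hk]
  refine ⟨fun i hi => by rw [hold i hi, hf₃.real 4 rfl, hf₂.real 4 rfl, hf₁.real 4 rfl], ?_, ?_⟩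
  · have hno := nearOptimal_gridRoots hm hL rfl hb0 (fun k hk => by rw [h6₂]; exact hle k hk)
      (by rw [h6₂]; exact hex) hroots
    refine hno.congr (fun k hk => by rw [h6₂, h6 k hk]) fun k hk => ?_
    rw [hnew k hk, hsum]
  · rw [hcost, hf₃.real 12 rfl, hf₂.real 12 rfl, hf₁.real 12 rfl, hf₃.real 2 rfl, hf₂.real 2 rfl,
      hf₁.real 2 rfl]
    congr 1
    exact Finset.sum_congr rfl fun k hk => by rw [h6₃ k (Finset.mem_range.1 hk)]

/-- The memory holds near-optimal memberships for the means, and the cost. -/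
def CostComputed (N E K m L : ℕ) (s : Store) : Prop :=
  (∀ n < N, NearOptimal K m (1 - 1 / (L : ℝ))⁻¹
    (fun k => sqDist E (s.real 1) (s.real 3) (n * E) (k * E)) fun k => s.real 4 (n * K + k)) ∧
  s.real 12 0 = ∑ n ∈ Finset.range N, ∑ k ∈ Finset.range K,
    s.real 4 (n * K + k) ^ m * s.real 2 n * sqDist E (s.real 1) (s.real 3) (n * E) (k * E)

theorem ends_costProgram {E U N K m L : ℕ} {s : Store} (hK0 : 1 ≤ K) (hm : 2 ≤ m) (hL : 2 ≤ L)
    (hNU : N ≤ U) (hKU : K ≤ U) (hmU : m ≤ U) (hMU : m * (K * L) ≤ U) (hN : s.nat 0 0 = N)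
    (hE : s.nat 0 1 = E) (hK : s.nat 0 2 = K) (hm' : s.nat 0 3 = m)
    (hM : s.nat 3 0 = m * (K * L)) :
    Ends E U costProgram s 90 (CostComputed N E K m L) := by
  refine Ends.setReal_seq (Ends.setNat_seq (Ends.setNat_seq ?_))
  -- `CostComputed` speaks of the arrays of the current store, so the invariant also records that
  -- points, weights and means are those of the start.
  refine (Ends.forLoop (e := 75) (B := N) (fun n s' => s'.nat 23 0 = n * E ∧ s'.nat 18 0 = n * K ∧
    s'.real 1 = s.real 1 ∧ s'.real 2 = s.real 2 ∧ s'.real 3 = s.real 3 ∧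
    CostComputed n E K m L s') hNU (fun s' h => ?_) ?_ ?_).mono (by norm_num)
    fun s' _ h => h.2.2.2.2.2
  · have := h.nat 0 rfl
    simpa [NatExpr.eval, this] using hN
  · simp [NatExpr.eval, RealExpr.eval, CostComputed]
  intro n hn s₁ hf₁ hn₁ ⟨h23, h18, h1₁, h2₁, h3₁, hnear, hcost⟩
  have h0₁ : s₁.nat 0 = s.nat 0 := by simpa using hf₁.nat 0 rfl
  have h3n₁ : s₁.nat 3 = s.nat 3 := by simpa using hf₁.nat 3 rfl
  refine Ends.seq ((ends_pointProgram hK0 hm hL hKU hmU hMU (by rw [h0₁, hE]) (by rw [h0₁, hK])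
    (by rw [h0₁, hm']) (by rw [h3n₁, hM]) hn₁ h23 h18).mono (by norm_num) fun _ _ h => h)
    fun s₂ hf₂ ⟨hold, hnew, hcost'⟩ => ?_
  have h0₂ : s₂.nat 0 = s.nat 0 := (hf₂.nat 0 rfl).trans h0₁
  have h1₂ : s₂.real 1 = s₁.real 1 := hf₂.real 1 rfl
  have h2₂ : s₂.real 2 = s₁.real 2 := hf₂.real 2 rfl
  have h3₂ : s₂.real 3 = s₁.real 3 := hf₂.real 3 rfl
  have hcell : ∀ i < n, ∀ k < K, s₂.real 4 (i * K + k) = s₁.real 4 (i * K + k) := by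
    intro i hi k hk
    refine hold _ ?_
    have : (i + 1) * K ≤ n * K := Nat.mul_le_mul_right _ hi
    rw [add_mul] at this
    omega
  refine Ends.setNat_seq (Ends.setNat ?_)
  refine ⟨by simp [NatExpr.eval, hf₂.nat 23 rfl, h23, h0₂, hE, add_mul],
    by simp [NatExpr.eval, hf₂.nat 18 rfl, h18, h0₂, hK, add_mul], h1₂.trans h1₁, h2₂.trans h2₁,
    h3₂.trans h3₁, ?_⟩
  simp only [CostComputed, Store.writeNat_real, h1₂, h2₂, h3₂]
  refine ⟨fun i hi => ?_, ?_⟩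
  · rcases Nat.lt_succ_iff_lt_or_eq.1 hi with h | rfl
    · exact (hnear i h).congr (fun _ _ => rfl) (hcell i h)
    · exact hnew
  · rw [hcost', hcost, Finset.sum_range_succ]
    congr 1
    refine Finset.sum_congr rfl fun i hi => Finset.sum_congr rfl fun k hk => ?_
    rw [hcell i (Finset.mem_range.1 hi) k (Finset.mem_range.1 hk)]

/-- Only the first `K * L` offsets are known to be digits of the candidate; this shows that the
means read no others. -/
theorem meansCell_congr {E L K i : ℕ} {X : ℕ → ℝ} {o o' : ℕ → ℕ} (hi : i < K * E)
    (h : ∀ j < K * L, o j = o' j) : meansCell E L X o i = meansCell E L X o' i := by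
  unfold meansCell
  congr 1
  refine Finset.sum_congr rfl fun l hl => ?_
  have hl := Finset.mem_range.1 hl
  have hk : i / E < K := Nat.div_lt_of_lt_mul (by rwa [mul_comm])
  have : (i / E + 1) * L ≤ K * L := Nat.mul_le_mul_right _ hk
  rw [add_mul] at this
  rw [h _ (by omega)]

theorem ends_evaluateProgram {E U N K m L c : ℕ} {s : Store} (hN0 : 1 ≤ N) (hE0 : 1 ≤ E)
    (hK0 : 1 ≤ K) (hm : 2 ≤ m) (hL : 2 ≤ L) (hNU : N ≤ U) (hKU : K ≤ U) (hmU : m ≤ U) (hLU : L ≤ U)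
    (hTU : K * L ≤ U) (hMU : m * (K * L) ≤ U) (hcU : c ≤ U) (hN : s.nat 0 0 = N)
    (hE : s.nat 0 1 = E) (hK : s.nat 0 2 = K) (hm' : s.nat 0 3 = m) (hL' : s.nat 1 0 = L)
    (hT : s.nat 2 0 = K * L) (hM : s.nat 3 0 = m * (K * L)) (hc : s.nat 5 0 = c) :
    Ends E U evaluateProgram s 100 (fun s' =>
      (∀ i < K * E, s'.real 3 i = meansCell E L (s.real 1) (fun j => c / N ^ j % N * E) i) ∧
      CostComputed N E K m L s') := by
  refine Ends.seq ((ends_digitsProgram hN0 hcU hTU hN hE hT hc).mono (by norm_num)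
    fun _ _ h => h) fun s₁ hf₁ h8 => ?_
  have h0₁ : s₁.nat 0 = s.nat 0 := hf₁.nat 0 rfl
  refine Ends.seq ((ends_meansProgram hE0 hKU hLU (by rw [h0₁, hE]) (by rw [h0₁, hK])
    (by rw [hf₁.nat 1 rfl, hL'])).mono (by norm_num) fun _ _ h => h) fun s₂ hf₂ h3 => ?_
  have h0₂ : s₂.nat 0 = s.nat 0 := (hf₂.nat 0 rfl).trans h0₁
  refine (ends_costProgram hK0 hm hL hNU hKU hmU hMU (by rw [h0₂, hN]) (by rw [h0₂, hE])
    (by rw [h0₂, hK]) (by rw [h0₂, hm']) (by rw [hf₂.nat 3 rfl, hf₁.nat 3 rfl, hM])).mono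
    (by norm_num) fun s₃ hf₃ h => ⟨fun i hi => ?_, h⟩
  rw [hf₃.real 3 rfl, h3 i hi, hf₁.real 1 rfl]
  exact meansCell_congr hi h8

theorem input_real_one {N D : ℕ} (K m : ℕ) (ε : ℝ) (x : Fin N → EuclideanSpace ℝ (Fin D))
    (w : Fin N → ℝ) (n : Fin N) (d : Fin D) : (input K m ε x w).real 1 (n * D + d) = x n d := by
  have hlt : (n : ℕ) * D + d < N * D := by
    have : ((n : ℕ) + 1) * D ≤ N * D := Nat.mul_le_mul_right _ n.2
    rw [add_mul] at this
    have := d.2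
    omega
  simp only [input, hlt, dif_pos]
  have hD : 0 < D := by have := d.2; omega
  have e1 : Fin.divNat (⟨n * D + d, hlt⟩ : Fin (N * D)) = n := by
    ext
    simp only [Fin.coe_divNat]
    rw [mul_comm, Nat.mul_add_div hD, Nat.div_eq_of_lt d.2, add_zero]
  have e2 : Fin.modNat (⟨n * D + d, hlt⟩ : Fin (N * D)) = d := by
    ext
    simp only [Fin.coe_modNat]
    rw [mul_comm, Nat.mul_add_mod, Nat.mod_eq_of_lt d.2]
  rw [e1, e2]

theorem input_real_two {N D : ℕ} (K m : ℕ) (ε : ℝ) (x : Fin N → EuclideanSpace ℝ (Fin D))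
    (w : Fin N → ℝ) (n : Fin N) : (input K m ε x w).real 2 n = w n := by
  simp [input]

end RealRAM

/-! ### The candidates contain good means -/

/-- The means of the samples with number `c`. -/
def candidateMeans {N D : ℕ} [NeZero N] (K L : ℕ) (x : Fin N → EuclideanSpace ℝ (Fin D)) (c : ℕ) :
    Fin K → EuclideanSpace ℝ (Fin D) :=
  fun k => (L : ℝ)⁻¹ • ∑ l ∈ Finset.range L, x (Fin.ofNat N (c / N ^ ((k : ℕ) * L + l)))

/-- The samples for the individual means are chosen independently, one for each weighting `r n k ^ m
* w n`. Together they form a word of length `K * L` over the points, and `c` is the number with this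
word as base `N` digits. -/
theorem exists_candidateMeans_cost_le {N D K L m : ℕ} [NeZero N] (hL : 0 < L)
    (x : Fin N → EuclideanSpace ℝ (Fin D)) {w : Fin N → ℝ} (hw : ∀ n, 0 ≤ w n)
    (μ : Fin K → EuclideanSpace ℝ (Fin D)) {r : Fin N → Fin K → ℝ} (hr : ∀ n k, 0 ≤ r n k) :
    ∃ c < N ^ (K * L), fuzzyCost m x w (candidateMeans K L x c) r ≤
      (1 + 1 / (L : ℝ)) * fuzzyCost m x w μ r := by
  have hex := fun k => exists_sample_mean_cost_le (fun n => r n k ^ m * w n)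
    (fun n => mul_nonneg (pow_nonneg (hr n k) m) (hw n)) x (μ k) hL
  choose σ hσ using hex
  let f : Fin (K * L) → Fin N := fun j => σ (Fin.divNat j) (Fin.modNat j)
  refine ⟨finFunctionFinEquiv f, (finFunctionFinEquiv f).2, ?_⟩
  have hcand : ∀ k, candidateMeans K L x (finFunctionFinEquiv f) k =
      (L : ℝ)⁻¹ • ∑ l ∈ Finset.range L, x (σ k l) := by
    intro k
    unfold candidateMeans
    congr 1
    refine Finset.sum_congr rfl fun l hl => ?_
    have hl := Finset.mem_range.1 hl
    have hlt : (k : ℕ) * L + l < K * L := by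
      have : ((k : ℕ) + 1) * L ≤ K * L := Nat.mul_le_mul_right _ k.2
      rw [add_mul] at this
      omega
    have h := congrFun (finFunctionFinEquiv.symm_apply_apply f) ⟨k * L + l, hlt⟩
    have e1 : Fin.divNat (⟨k * L + l, hlt⟩ : Fin (K * L)) = k := by
      ext
      simp only [Fin.coe_divNat]
      rw [mul_comm, Nat.mul_add_div hL, Nat.div_eq_of_lt hl, add_zero]
    have e2 : ((Fin.modNat (⟨k * L + l, hlt⟩ : Fin (K * L)) : Fin L) : ℕ) = l := by
      simp only [Fin.coe_modNat]
      rw [mul_comm, Nat.mul_add_mod, Nat.mod_eq_of_lt hl]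
    simp only [f, e1, e2] at h
    rw [← h]
    congr 1
  unfold fuzzyCost
  rw [Finset.sum_comm, Finset.sum_comm (f := fun n k => r n k ^ m * w n * ‖x n - μ k‖ ^ 2),
    Finset.mul_sum]
  refine Finset.sum_le_sum fun k _ => ?_
  rw [hcand]
  exact hσ k

namespace RealRAM

/-- The memory holds the means of candidate `c`, near-optimal memberships, and their cost. -/
structure Evaluated {N D K : ℕ} [NeZero N] (m L : ℕ) (x : Fin N → EuclideanSpace ℝ (Fin D))
    (w : Fin N → ℝ) (c : ℕ) (s : Store) : Prop where
  means : outputMeans D K s = candidateMeans K L x c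
  memberships : IsMembership (outputMemberships N K s)
  cost : s.real 12 0 = fuzzyCost m x w (candidateMeans K L x c) (outputMemberships N K s)
  nearOptimal : ∀ r, IsMembership r → s.real 12 0 ≤
    (1 - 1 / (L : ℝ))⁻¹ * fuzzyCost m x w (candidateMeans K L x c) r

theorem evaluated_of_costComputed {N D K m L c : ℕ} [NeZero N] {ε : ℝ}
    {x : Fin N → EuclideanSpace ℝ (Fin D)} {w : Fin N → ℝ} {s : Store} (hw : ∀ n, 0 ≤ w n)
    (hX : s.real 1 = (input K m ε x w).real 1) (hW : s.real 2 = (input K m ε x w).real 2)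
    (hmeans : ∀ i < K * D,
      s.real 3 i = meansCell D L (s.real 1) (fun j => c / N ^ j % N * D) i)
    (hcost : CostComputed N D K m L s) : Evaluated (K := K) m L x w c s := by
  have hμ : outputMeans D K s = candidateMeans K L x c := by
    funext k
    ext d
    have hd : 0 < D := by have := d.2; omega
    have hlt : (k : ℕ) * D + d < K * D := by
      have : ((k : ℕ) + 1) * D ≤ K * D := Nat.mul_le_mul_right _ k.2
      rw [add_mul] at this
      have := d.2
      omega
    have e1 : ((k : ℕ) * D + d) / D = k := by
      rw [mul_comm, Nat.mul_add_div hd, Nat.div_eq_of_lt d.2, add_zero]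
    have e2 : ((k : ℕ) * D + d) % D = d := by
      rw [mul_comm, Nat.mul_add_mod, Nat.mod_eq_of_lt d.2]
    simp only [outputMeans, candidateMeans, hmeans _ hlt, meansCell, e1, e2, PiLp.smul_apply,
      smul_eq_mul, WithLp.ofLp_sum, Finset.sum_apply]
    rw [div_eq_inv_mul]
    congr 1
    refine Finset.sum_congr rfl fun l _ => ?_
    rw [hX]
    exact input_real_one K m ε x w (Fin.ofNat N (c / N ^ ((k : ℕ) * L + l))) d
  have hdist : ∀ (n : Fin N) (k : Fin K), sqDist D (s.real 1) (s.real 3) (n * D) (k * D) =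
      ‖x n - candidateMeans K L x c k‖ ^ 2 := by
    intro n k
    rw [← hμ, EuclideanSpace.real_norm_sq_eq, sqDist, Finset.sum_range]
    refine Finset.sum_congr rfl fun d _ => ?_
    rw [hX, input_real_one K m ε x w n d, sq]
    rfl
  obtain ⟨hnear, htotal⟩ := hcost
  have hmem : IsMembership (outputMemberships N K s) := by
    have hsum : ∀ n : Fin N, ∑ k, outputMemberships N K s n k = 1 := by
      intro n
      rw [← (hnear n n.2).2.1, Finset.sum_range]
      rfl
    have h0 : ∀ n k, 0 ≤ outputMemberships N K s n k := fun n k => (hnear n n.2).1 k k.2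
    refine ⟨fun n k => ⟨h0 n k, ?_⟩, hsum⟩
    rw [← hsum n]
    exact Finset.single_le_sum (fun k _ => h0 n k) (Finset.mem_univ k)
  have hc : s.real 12 0 =
      fuzzyCost m x w (candidateMeans K L x c) (outputMemberships N K s) := by
    rw [htotal, fuzzyCost, Finset.sum_range]
    refine Finset.sum_congr rfl fun n _ => ?_
    rw [Finset.sum_range]
    refine Finset.sum_congr rfl fun k _ => ?_
    rw [hdist, hW, input_real_two]
    rfl
  refine ⟨hμ, hmem, hc, fun r hr => ?_⟩
  rw [hc, fuzzyCost, fuzzyCost, Finset.mul_sum]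
  refine Finset.sum_le_sum fun n _ => ?_
  -- Memberships are extended by zero from `Fin K` to all natural numbers, the form in which
  -- `NearOptimal` competes.
  have h := (hnear n n.2).2.2 (fun k => if h : k < K then r n ⟨k, h⟩ else 0)
    (fun k hk => by simpa [hk] using (hr.1 n ⟨k, hk⟩).1)
    (by rw [← hr.2 n, Finset.sum_range]; simp)
  simp only [Finset.sum_range, hdist, Fin.is_lt, dif_pos, Fin.eta] at h
  calc ∑ k, outputMemberships N K s n k ^ m * w n * ‖x n - candidateMeans K L x c k‖ ^ 2
      = w n * ∑ k, outputMemberships N K s n k ^ m * ‖x n - candidateMeans K L x c k‖ ^ 2 := by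
        rw [Finset.mul_sum]; exact Finset.sum_congr rfl fun k _ => by ring
    _ ≤ w n * ((1 - 1 / (L : ℝ))⁻¹ *
        ∑ k, r n k ^ m * ‖x n - candidateMeans K L x c k‖ ^ 2) :=
        mul_le_mul_of_nonneg_left h (hw n)
    _ = _ := by
        rw [← mul_assoc, mul_comm (w n), mul_assoc, Finset.mul_sum]
        congr 1
        exact Finset.sum_congr rfl fun k _ => by ring


/-! ### The exhaustive search -/

/-- The preparations of the search are done. -/
structure Ready {N D : ℕ} (K m L : ℕ) (ε : ℝ) (x : Fin N → EuclideanSpace ℝ (Fin D))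
    (w : Fin N → ℝ) (s : Store) : Prop where
  nat_zero : s.nat 0 = (input K m ε x w).nat 0
  real_one : s.real 1 = (input K m ε x w).real 1
  real_two : s.real 2 = (input K m ε x w).real 2
  sampleSize : s.nat 1 0 = L
  digits : s.nat 2 0 = K * L
  gridSize : s.nat 3 0 = m * (K * L)

theorem Ready.of_eq {N D K m L : ℕ} {ε : ℝ} {x : Fin N → EuclideanSpace ℝ (Fin D)} {w : Fin N → ℝ}
    {s s' : Store} (h : Ready K m L ε x w s) (h0 : s'.nat 0 = s.nat 0) (h1 : s'.nat 1 = s.nat 1)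
    (h2 : s'.nat 2 = s.nat 2) (h3 : s'.nat 3 = s.nat 3) (hr1 : s'.real 1 = s.real 1)
    (hr2 : s'.real 2 = s.real 2) : Ready K m L ε x w s' :=
  ⟨h0.trans h.nat_zero, hr1.trans h.real_one, hr2.trans h.real_two, by rw [h1, h.sampleSize],
    by rw [h2, h.digits], by rw [h3, h.gridSize]⟩

/-- All sizes of the instance are at most `U`. -/
structure SizesLE (N K m L U : ℕ) : Prop where
  points : N ≤ U
  means : K ≤ U
  fuzzifier : m ≤ U
  sampleSize : L ≤ U
  digits : K * L ≤ U
  gridSize : m * (K * L) ≤ U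
  candidates : N ^ (K * L) ≤ U

theorem ends_setupProgram {N D K m U : ℕ} {ε : ℝ} {x : Fin N → EuclideanSpace ℝ (Fin D)}
    {w : Fin N → ℝ} (hN0 : 1 ≤ N) (hε : 0 < ε) (hU : SizesLE N K m ⌈8 / ε⌉₊ U) :
    Ends D U setupProgram (input K m ε x w) 40 (fun s' =>
      Ready K m ⌈8 / ε⌉₊ ε x w s' ∧ s'.nat 4 0 = N ^ (K * ⌈8 / ε⌉₊)) := by
  set s := input K m ε x w with hs
  set L := ⌈8 / ε⌉₊ with hL
  have hN : s.nat 0 0 = N := rfl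
  have hK : s.nat 0 2 = K := rfl
  have hm : s.nat 0 3 = m := rfl
  have hr : s.real 0 0 = ε := by simp [hs, input]
  refine Ends.seq (R := fun s' => s'.nat 1 0 = L) ?_ ?_
  -- Reals cannot be converted to natural numbers, so `⌈8 / ε⌉₊` is found by counting up until the
  -- counter times `ε` reaches `8`.
  · refine (Ends.while_counted (e := 3) (B := L) (fun k s' => s'.nat 1 0 = k) hU.sampleSize rfl
      ?_ ?_).mono (by norm_num) fun _ _ h => h
    · intro k hk s₁ hf₁ h1
      refine ⟨?_, Ends.setNat ?_⟩
      · simp only [Test.Holds, RealExpr.eval, NatExpr.eval, h1, hf₁.real 0 rfl, hr]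
        have := Nat.lt_ceil.1 hk
        rw [lt_div_iff₀ hε] at this
        exact_mod_cast this
      · simp [NatExpr.eval, h1]
    · intro s₁ hf₁ h1
      simp only [Test.Holds, RealExpr.eval, NatExpr.eval, h1, hf₁.real 0 rfl, hr, not_lt]
      have := Nat.le_ceil (8 / ε)
      rw [div_le_iff₀ hε] at this
      exact_mod_cast this
  intro s₁ hf₁ h1
  have h0₁ : s₁.nat 0 = s.nat 0 := hf₁.nat 0 rfl
  refine Ends.seq ((ends_mulNat (A := K) (B := L) hU.means (by norm_num) ?_ ?_).mono
    (by norm_num) fun _ _ h => h) fun s₂ hf₂ h2 => ?_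
  · intro s' h
    simp only [NatExpr.eval, h.nat 0 rfl, h0₁, hK]
  · intro s' h
    simp only [NatExpr.eval, h.nat 1 rfl, h1]
  have h0₂ : s₂.nat 0 = s.nat 0 := (hf₂.nat 0 rfl).trans h0₁
  refine Ends.seq ((ends_mulNat (A := m) (B := K * L) hU.fuzzifier (by norm_num) ?_ ?_).mono
    (by norm_num) fun _ _ h => h) fun s₃ hf₃ h3 => ?_
  · intro s' h
    simp only [NatExpr.eval, h.nat 0 rfl, h0₂, hm]
  · intro s' h
    simp only [NatExpr.eval, h.nat 2 rfl, h2]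
  have h0₃ : s₃.nat 0 = s.nat 0 := (hf₃.nat 0 rfl).trans h0₂
  have hready : Ready K m L ε x w s₃ := ⟨h0₃,
    by rw [hf₃.real 1 rfl, hf₂.real 1 rfl, hf₁.real 1 rfl],
    by rw [hf₃.real 2 rfl, hf₂.real 2 rfl, hf₁.real 2 rfl],
    by rw [hf₃.nat 1 rfl, hf₂.nat 1 rfl, h1], by rw [hf₃.nat 2 rfl, h2], h3⟩
  refine Ends.setNat_seq ?_
  refine (Ends.forLoop (e := 20) (B := K * L) (fun j s' => s'.nat 4 0 = N ^ j) hU.digits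
    (fun s' h => ?_) ?_ ?_).mono (by norm_num) fun s' hf h => ⟨?_, h⟩
  · have := h.nat 2 rfl
    simpa [NatExpr.eval, this] using hready.digits
  · simp [NatExpr.eval]
  · intro j hj s₄ hf₄ _ h4
    have h0₄ : s₄.nat 0 = s.nat 0 := by simpa [h0₃] using hf₄.nat 0 rfl
    refine Ends.seq ((ends_mulNat (A := N ^ j) (B := N)
      ((Nat.pow_le_pow_right hN0 hj.le).trans hU.candidates) (by norm_num) ?_ ?_).mono
      (by norm_num) fun _ _ h => h) fun s₅ hf₅ h9 => Ends.setNat ?_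
    · intro s' h
      simp only [NatExpr.eval, h.nat 4 rfl, h4]
    · intro s' h
      simp only [NatExpr.eval, h.nat 0 rfl, h0₄, hN]
    · simp [NatExpr.eval, h9, pow_succ]
  · exact hready.of_eq (by simpa using hf.nat 0 rfl) (by simpa using hf.nat 1 rfl)
      (by simpa using hf.nat 2 rfl) (by simpa using hf.nat 3 rfl) (by simpa using hf.real 1 rfl)
      (by simpa using hf.real 2 rfl)

theorem ends_evaluateProgram_of_ready {N D K m L U c : ℕ} [NeZero N] {ε : ℝ}
    {x : Fin N → EuclideanSpace ℝ (Fin D)} {w : Fin N → ℝ} {s : Store} (hw : ∀ n, 0 ≤ w n)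
    (hN0 : 1 ≤ N) (hD0 : 1 ≤ D) (hK0 : 1 ≤ K) (hm : 2 ≤ m) (hL : 2 ≤ L) (hU : SizesLE N K m L U)
    (hs : Ready K m L ε x w s) (hc : s.nat 5 0 = c) (hcU : c ≤ U) :
    Ends D U evaluateProgram s 100 (Evaluated (K := K) m L x w c) := by
  refine (ends_evaluateProgram hN0 hD0 hK0 hm hL hU.points hU.means hU.fuzzifier hU.sampleSize
    hU.digits hU.gridSize hcU (by rw [hs.nat_zero]; rfl) (by rw [hs.nat_zero]; rfl)
    (by rw [hs.nat_zero]; rfl) (by rw [hs.nat_zero]; rfl) hs.sampleSize hs.digits hs.gridSize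
    hc).mono le_rfl fun s' hf ⟨hmeans, hcost⟩ => ?_
  have h1 : s'.real 1 = s.real 1 := hf.real 1 rfl
  refine evaluated_of_costComputed (ε := ε) hw (h1.trans hs.real_one)
    ((hf.real 2 rfl).trans hs.real_two) ?_ hcost
  rw [h1]
  exact hmeans

theorem Ready.of_evaluateProgram {N D K m L : ℕ} {ε : ℝ} {x : Fin N → EuclideanSpace ℝ (Fin D)}
    {w : Fin N → ℝ} {s s' : Store} (h : Ready K m L ε x w s) (hf : Frame evaluateProgram s s') :
    Ready K m L ε x w s' :=
  h.of_eq (hf.nat 0 rfl) (hf.nat 1 rfl) (hf.nat 2 rfl) (hf.nat 3 rfl) (hf.real 1 rfl)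
    (hf.real 2 rfl)

/-- Cell `0` of the array `21` holds a candidate which is nearly optimal among the first `i`
candidates. -/
def BestOf {N D : ℕ} [NeZero N] (K m L : ℕ) (x : Fin N → EuclideanSpace ℝ (Fin D)) (w : Fin N → ℝ)
    (i : ℕ) (s : Store) : Prop :=
  s.nat 21 0 < N ^ (K * L) ∧
  (∃ r, IsMembership r ∧
    s.real 13 0 = fuzzyCost m x w (candidateMeans K L x (s.nat 21 0)) r) ∧
  ∀ c < i, ∀ r, IsMembership r →
    s.real 13 0 ≤ (1 - 1 / (L : ℝ))⁻¹ * fuzzyCost m x w (candidateMeans K L x c) r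

/-- Each computed cost is within `ρ` of the optimal cost for its own means, so the least computed
cost is within `ρ` of the cost of every candidate with any memberships. Candidate `0`, which exists
because `N` is positive, initialises the record. -/
theorem ends_searchProgram {N D K m L U : ℕ} [NeZero N] {ε : ℝ}
    {x : Fin N → EuclideanSpace ℝ (Fin D)} {w : Fin N → ℝ} {s : Store} (hw : ∀ n, 0 ≤ w n)
    (hN0 : 1 ≤ N) (hD0 : 1 ≤ D) (hK0 : 1 ≤ K) (hm : 2 ≤ m) (hL : 2 ≤ L) (hU : SizesLE N K m L U)
    (hs : Ready K m L ε x w s) (hQ : s.nat 4 0 = N ^ (K * L)) :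
    Ends D U searchProgram s 130 (BestOf K m L x w (N ^ (K * L))) := by
  have hQ0 : 0 < N ^ (K * L) := Nat.pow_pos hN0
  have hs' : Ready K m L ε x w (s.writeNat 5 0 0) := hs.of_eq (by simp) (by simp) (by simp) (by simp)
    (by simp) (by simp)
  refine Ends.setNat_seq ?_
  refine Ends.seq ((ends_evaluateProgram_of_ready hw hN0 hD0 hK0 hm hL hU hs' (by simp)
    (Nat.zero_le _)).mono (by norm_num) fun _ _ h => h) fun s₁ hf₁ hev => ?_
  have hs₁ : Ready K m L ε x w s₁ := hs'.of_evaluateProgram hf₁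
  refine Ends.setReal_seq (Ends.setNat_seq ?_)
  set s₂ := (s₁.writeReal 13 ((NatExpr.lit 0).eval s₁) ((realVar 12).eval s₁)).writeNat 21 0 0
  have hs₂ : Ready K m L ε x w s₂ := hs₁.of_eq (by simp [s₂]) (by simp [s₂]) (by simp [s₂])
    (by simp [s₂]) (by simp [s₂]) (by simp [s₂])
  refine (Ends.forLoop (e := 110) (B := N ^ (K * L)) (BestOf K m L x w) hU.candidates
    (fun s' h => ?_) ?_ ?_ (hI := ?_)).mono (by norm_num) fun s' _ h => h
  · have h4 := h.nat 4 rfl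
    have h4₁ := hf₁.nat 4 rfl
    simp [NatExpr.eval, h4, h4₁, hQ]
  · refine ⟨by simpa [NatExpr.eval] using hQ0, ⟨_, hev.memberships, ?_⟩, fun c hc => by omega⟩
    simp [NatExpr.eval, RealExpr.eval, hev.cost]
  · intro i hi s₃ hf₃ hi₃ ⟨hlt, hbest, hopt⟩
    have hs₃ : Ready K m L ε x w (s₃.writeNat 5 0 i) := hs₂.of_eq
      (by simpa [s₂] using hf₃.nat 0 rfl) (by simpa [s₂] using hf₃.nat 1 rfl)
      (by simpa [s₂] using hf₃.nat 2 rfl) (by simpa [s₂] using hf₃.nat 3 rfl)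
      (by simpa [s₂] using hf₃.real 1 rfl) (by simpa [s₂] using hf₃.real 2 rfl)
    refine Ends.setNat_seq ?_
    simp only [NatExpr.eval, hi₃]
    refine Ends.seq ((ends_evaluateProgram_of_ready hw hN0 hD0 hK0 hm hL hU hs₃ (by simp)
      (hi.le.trans hU.candidates)).mono (by norm_num) fun _ _ h => h) fun s₄ hf₄ hev₄ => ?_
    have h13 : s₄.real 13 = s₃.real 13 := by simpa using hf₄.real 13 rfl
    have h21 : s₄.nat 21 = s₃.nat 21 := by simpa using hf₄.nat 21 rfl
    have h22 : s₄.nat 22 0 = i := by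
      rw [← hi₃]; simpa using congrFun (hf₄.nat 22 rfl) 0
    refine Ends.ite (fun hb => Ends.setReal_seq (e := 106) (Ends.setNat ?_))
      fun hb => Ends.skip ?_ (by norm_num)
    all_goals simp only [Test.Holds, NatExpr.eval, RealExpr.eval, h13, not_lt] at hb
    · simp only [BestOf, NatExpr.eval, RealExpr.eval, Store.writeNat_nat_self, Store.writeReal_nat,
        h22, Store.writeNat_real, Store.writeReal_real_self]
      refine ⟨hi, ⟨_, hev₄.memberships, hev₄.cost⟩, fun c hc r hr => ?_⟩
      rcases Nat.lt_succ_iff_lt_or_eq.1 hc with h | rfl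
      · exact hb.le.trans (hopt c h r hr)
      · exact hev₄.nearOptimal r hr
    · simp only [BestOf, h13, h21]
      refine ⟨hlt, hbest, fun c hc r hr => ?_⟩
      rcases Nat.lt_succ_iff_lt_or_eq.1 hc with h | rfl
      · exact hopt c h r hr
      · exact hb.trans (hev₄.nearOptimal r hr)
  · exact fun _ _ _ h => h

/-! ### The approximation guarantee -/

/-- With `u = 1 / L` and `8 * u ≤ ε` it suffices that `1 + u ≤ (1 - u) ^ 2 * (1 + 8 * u)`. The
difference of the two sides is `u * (5 - 15 * u + 8 * u ^ 2)`, nonnegative for `u ≤ 1 / 8`; this is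
where the `8` in the sample size is used. -/
theorem approx_factor_le {L ε : ℝ} (hε : 0 < ε) (hε1 : ε ≤ 1) (hL : 8 / ε ≤ L) :
    (1 - 1 / L)⁻¹ * ((1 - 1 / L)⁻¹ * (1 + 1 / L)) ≤ 1 + ε := by
  have hL0 : 0 < L := lt_of_lt_of_le (by positivity) hL
  set u := 1 / L with hu
  have hu0 : 0 < u := by positivity
  have huε : 8 * u ≤ ε := by
    rw [div_le_iff₀ hε] at hL
    rw [hu, mul_one_div, div_le_iff₀ hL0]
    linarith
  have h1u : 0 < 1 - u := by linarith
  rw [inv_mul_le_iff₀ h1u, inv_mul_le_iff₀ h1u]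
  nlinarith [mul_nonneg (mul_nonneg h1u.le h1u.le) (sub_nonneg.2 huε),
    mul_nonneg hu0.le (show (0 : ℝ) ≤ 5 - 15 * u + 8 * u ^ 2 by nlinarith)]

/-- Comparing with every pair of means and memberships avoids showing that the infimum is attained.
The set of costs is nonempty because `1 ≤ K` allows all membership to go to the first mean. -/
theorem le_mul_optCost {N D K m : ℕ} {x : Fin N → EuclideanSpace ℝ (Fin D)} {w : Fin N → ℝ}
    {a b : ℝ} (hK0 : 1 ≤ K) (hb : 0 < b)
    (h : ∀ μ r, IsMembership r → a ≤ b * fuzzyCost m x w (K := K) μ r) :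
    a ≤ b * optCost K m x w := by
  rw [← div_le_iff₀' hb]
  refine le_csInf ?_ ?_
  · refine ⟨_, fun _ => 0, fun _ k => if k = ⟨0, hK0⟩ then 1 else 0, ⟨fun n k => ?_, fun n => ?_⟩,
      rfl⟩
    · dsimp only
      split_ifs <;> norm_num
    · simp
  · rintro _ ⟨μ, r, hr, rfl⟩
    rw [div_le_iff₀' hb]
    exact h μ r hr

/-- The program is correct, with running time linear in the dimension and polynomial in a bound of
the other sizes. -/
theorem ends_fuzzyProgram {N D K m U : ℕ} {ε : ℝ} {x : Fin N → EuclideanSpace ℝ (Fin D)}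
    {w : Fin N → ℝ} (hw : ∀ n, 0 ≤ w n) (hN0 : 1 ≤ N) (hD0 : 1 ≤ D) (hK0 : 1 ≤ K) (hm : 2 ≤ m)
    (hε : 0 < ε) (hε1 : ε ≤ 1) (hU : SizesLE N K m ⌈8 / ε⌉₊ U) :
    Ends D U fuzzyProgram (input K m ε x w) 140 (fun s =>
      IsMembership (outputMemberships N K s) ∧
      fuzzyCost m x w (outputMeans D K s) (outputMemberships N K s) ≤
        (1 + ε) * optCost K m x w) := by
  have : NeZero N := ⟨by omega⟩
  have hL8 : (8 : ℝ) / ε ≤ ⌈8 / ε⌉₊ := Nat.le_ceil _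
  have hL2 : 2 ≤ ⌈8 / ε⌉₊ := by
    have h8 : (8 : ℝ) ≤ 8 / ε := by rw [le_div_iff₀ hε]; nlinarith
    have : ((2 : ℕ) : ℝ) ≤ (⌈8 / ε⌉₊ : ℝ) := by push_cast; linarith
    exact_mod_cast this
  set L := ⌈8 / ε⌉₊
  refine Ends.seq ((ends_setupProgram hN0 hε hU).mono (by norm_num) fun _ _ h => h)
    fun s₁ hf₁ ⟨hs₁, hQ⟩ => ?_
  refine Ends.seq ((ends_searchProgram hw hN0 hD0 hK0 hm hL2 hU hs₁ hQ).mono (by norm_num)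
    fun _ _ h => h) fun s₂ hf₂ ⟨hlt, ⟨r₀, hr₀, hbest⟩, hopt⟩ => ?_
  refine Ends.setNat_seq ?_
  simp only [NatExpr.eval]
  set c := s₂.nat 21 0
  have hs₂ : Ready K m L ε x w (s₂.writeNat 5 0 c) := hs₁.of_eq
    (by simpa using hf₂.nat 0 rfl) (by simpa using hf₂.nat 1 rfl) (by simpa using hf₂.nat 2 rfl)
    (by simpa using hf₂.nat 3 rfl) (by simpa using hf₂.real 1 rfl) (by simpa using hf₂.real 2 rfl)
  refine (ends_evaluateProgram_of_ready hw hN0 hD0 hK0 hm hL2 hU hs₂ (by simp)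
    (hlt.le.trans hU.candidates)).mono (by norm_num) fun s₃ _ hev => ⟨hev.memberships, ?_⟩
  refine le_mul_optCost hK0 (by linarith) fun μ r hr => ?_
  have hL0 : (0 : ℝ) < L := by exact_mod_cast (by omega : 0 < L)
  have hρ : 0 ≤ (1 - 1 / (L : ℝ))⁻¹ := by
    refine inv_nonneg.2 (sub_nonneg.2 ?_)
    rw [div_le_one hL0]
    exact_mod_cast (by omega : 1 ≤ L)
  obtain ⟨c', hc', hle⟩ := exists_candidateMeans_cost_le (m := m) (L := L) (by omega) x hw μ
    (fun n k => (hr.1 n k).1)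
  have hcost0 : 0 ≤ fuzzyCost m x w μ r := Finset.sum_nonneg fun n _ => Finset.sum_nonneg fun k _ =>
    mul_nonneg (mul_nonneg (pow_nonneg (hr.1 n k).1 m) (hw n)) (sq_nonneg _)
  set ρ := (1 - 1 / (L : ℝ))⁻¹
  rw [hev.means, ← hev.cost]
  -- The second factor `ρ` comes from the final evaluation: of the recorded cost it is only known
  -- that some memberships `r₀` realise it, and the recomputed ones are compared with these.
  calc s₃.real 12 0 ≤ ρ * fuzzyCost m x w (candidateMeans K L x c) r₀ := hev.nearOptimal r₀ hr₀
    _ = ρ * s₂.real 13 0 := by rw [hbest]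
    _ ≤ ρ * (ρ * fuzzyCost m x w (candidateMeans K L x c') r) :=
        mul_le_mul_of_nonneg_left (hopt c' hc' r hr) hρ
    _ ≤ ρ * (ρ * ((1 + 1 / (L : ℝ)) * fuzzyCost m x w μ r)) := by gcongr
    _ = ρ * (ρ * (1 + 1 / (L : ℝ))) * fuzzyCost m x w μ r := by ring
    _ ≤ (1 + ε) * fuzzyCost m x w μ r :=
        mul_le_mul_of_nonneg_right (approx_factor_le hε hε1 hL8) hcost0


/-! ### Bounds for the running time -/

/-- Base at least 2 is needed because `K`, `L` and `m` are bounded through `n < 2 ^ n`; powers of `N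
= 1` would not do. -/
theorem sizesLE_max_pow {N K m L : ℕ} (hK : 1 ≤ K) (hm : 1 ≤ m) (hL : 1 ≤ L) :
    SizesLE N K m L (max N 2 ^ (K * L * m)) := by
  have hH : 1 ≤ K * L * m := Nat.mul_pos (Nat.mul_pos hK hL) hm
  have hle : K * L * m ≤ max N 2 ^ (K * L * m) :=
    Nat.lt_two_pow_self.le.trans (Nat.pow_le_pow_left (le_max_right _ _) _)
  have hKL : K * L ≤ K * L * m := Nat.le_mul_of_pos_right _ hm
  refine ⟨(le_max_left N 2).trans (Nat.le_self_pow (by omega) _),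
    (Nat.le_mul_of_pos_right _ hL).trans (hKL.trans hle),
    (Nat.le_mul_of_pos_left _ (Nat.mul_pos hK hL)).trans hle,
    (Nat.le_mul_of_pos_left _ hK).trans (hKL.trans hle), hKL.trans hle, by rwa [mul_comm m], ?_⟩
  exact (Nat.pow_le_pow_left (le_max_left _ _) _).trans
    (Nat.pow_le_pow_right (by omega) hKL)

/-- For fixed `K`, `m`, `L` this bound is a constant times a power of `N` itself, as the polynomial
bound requires also for `N = 1`. -/
theorem sizesLE_mul_pow {N K m L : ℕ} (hN : 1 ≤ N) (hK : 1 ≤ K) (hm : 1 ≤ m) (hL : 1 ≤ L) :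
    SizesLE N K m L (K * L * m * N ^ (K * L * m)) := by
  have hH : 1 ≤ K * L * m := Nat.mul_pos (Nat.mul_pos hK hL) hm
  have hle : K * L * m ≤ K * L * m * N ^ (K * L * m) :=
    Nat.le_mul_of_pos_right _ (Nat.pow_pos hN)
  have hle' : N ^ (K * L * m) ≤ K * L * m * N ^ (K * L * m) := Nat.le_mul_of_pos_left _ hH
  have hKL : K * L ≤ K * L * m := Nat.le_mul_of_pos_right _ hm
  exact ⟨(Nat.le_self_pow (by omega) _).trans hle',
    (Nat.le_mul_of_pos_right _ hL).trans (hKL.trans hle),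
    (Nat.le_mul_of_pos_left _ (Nat.mul_pos hK hL)).trans hle,
    (Nat.le_mul_of_pos_left _ hK).trans (hKL.trans hle), hKL.trans hle, by rwa [mul_comm m],
    (Nat.pow_le_pow_right hN hKL).trans hle'⟩

theorem time_le_max_pow {N D H e t : ℕ} (hD : 1 ≤ D) (hH : 2 ≤ H)
    (ht : t ≤ (D + 1) * (max N 2 ^ H + 4) ^ e) : t ≤ D * max N 2 ^ ((2 * e + 1) * H) := by
  set U := max N 2 ^ H with hU
  have hU4 : 4 ≤ U := by
    calc 4 = 2 ^ 2 := by norm_num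
      _ ≤ max N 2 ^ 2 := Nat.pow_le_pow_left (le_max_right _ _) _
      _ ≤ U := Nat.pow_le_pow_right (by omega) hH
  -- Since `4 ≤ U`, both `U + 4 ≤ U ^ 2` and `D + 1 ≤ D * U` hold, which accounts for the exponent
  -- `2 * e + 1`.
  calc t ≤ (D + 1) * (U + 4) ^ e := ht
    _ ≤ (D * U) * (U ^ 2) ^ e := by
        refine Nat.mul_le_mul (by nlinarith) (Nat.pow_le_pow_left (by nlinarith) _)
    _ = D * max N 2 ^ ((2 * e + 1) * H) := by
        rw [mul_comm (2 * e + 1) H, pow_mul, ← hU]; ring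

end RealRAM

theorem zero_le_log_iSup_div_iInf {ι : Type*} [Finite ι] [Nonempty ι] {w : ι → ℝ}
    (hw : ∀ i, 0 < w i) : 0 ≤ Real.log ((⨆ i, w i) / ⨅ i, w i) := by
  obtain ⟨i, hi⟩ := exists_eq_ciInf_of_finite (f := w)
  refine Real.log_nonneg ?_
  rw [one_le_div (by rw [← hi]; exact hw i), ← hi]
  exact le_ciSup (Set.finite_range w).bddAbove i

/-- The exponent of the running time is at most a constant multiple of the bound in the theorem. -/
theorem exponent_le {K m : ℕ} {ε l : ℝ} (hK : 1 ≤ K) (hm : 2 ≤ m) (hε : 0 < ε) (hε1 : ε ≤ 1)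
    (hl : 0 ≤ l) :
    ((K * ⌈8 / ε⌉₊ * m : ℕ) : ℝ) ≤ 36 * ((K : ℝ) ^ 2 * Real.log (max (K : ℝ) 2) * (1 / ε) *
      ((m : ℝ) * Real.log ((m : ℝ) / ε) + l)) := by
  have hK' : (1 : ℝ) ≤ K := by exact_mod_cast hK
  have hm' : (2 : ℝ) ≤ m := by exact_mod_cast hm
  have hlog2 : (1 / 2 : ℝ) ≤ Real.log 2 := by linarith [Real.log_two_gt_d9]
  have hL : (⌈8 / ε⌉₊ : ℝ) ≤ 9 * (1 / ε) := by
    have h1 : (1 : ℝ) ≤ 1 / ε := by rw [le_div_iff₀ hε]; linarith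
    have h2 := (Nat.ceil_lt_add_one (show 0 ≤ 8 / ε by positivity)).le
    have h3 : 8 / ε = 8 * (1 / ε) := by ring
    linarith
  have hlogK : (1 / 2 : ℝ) ≤ Real.log (max (K : ℝ) 2) :=
    hlog2.trans (Real.log_le_log (by norm_num) (le_max_right _ _))
  have hlogm : (1 / 2 : ℝ) ≤ Real.log ((m : ℝ) / ε) := by
    refine hlog2.trans (Real.log_le_log (by norm_num) ?_)
    rw [le_div_iff₀ hε]
    nlinarith
  push_cast
  -- The constant is `36 = 9 * 2 * 2`: the ceiling is at most `9 / ε`, and each of the two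
  -- logarithms is at least `1 / 2`. The weight term `l` is only bounded below by `0`.
  calc (K : ℝ) * ⌈8 / ε⌉₊ * m ≤ (K : ℝ) ^ 2 * (9 * (1 / ε)) * m := by
        have : (K : ℝ) ≤ (K : ℝ) ^ 2 := by nlinarith
        gcongr
    _ = 36 * ((K : ℝ) ^ 2 * (1 / 2) * (1 / ε) * (m * (1 / 2) + 0)) := by ring
    _ ≤ _ := by gcongr

end

theorem theorem2 :
    ∃ (p : RealRAM.Program) (c : ℝ), 0 < c ∧
      -- correctness and running time on all inputs
      (∀ (N D K m : ℕ) (ε : ℝ) (x : Fin N → EuclideanSpace ℝ (Fin D)) (w : Fin N → NNRat),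
        1 ≤ N → 1 ≤ D → 1 ≤ K → 2 ≤ m → 0 < ε → ε ≤ 1 →
        ∃ (t : ℕ) (s : RealRAM.Store),
          RealRAM.Run p (RealRAM.input K m ε x (fun n => (w n : ℝ))) t s ∧
          IsMembership (RealRAM.outputMemberships N K s) ∧
          fuzzyCost m x (fun n => (w n : ℝ))
              (RealRAM.outputMeans D K s) (RealRAM.outputMemberships N K s)
            ≤ (1 + ε) * optCost K m x (fun n => (w n : ℝ)) ∧
          ((∀ n, 0 < w n) →
            (t : ℝ) ≤ (D : ℝ) * (max (N : ℝ) 2) ^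
              (c * ((K : ℝ) ^ 2 * Real.log (max (K : ℝ) 2) * (1 / ε) *
                ((m : ℝ) * Real.log ((m : ℝ) / ε) +
                  Real.log ((⨆ n, (w n : ℝ)) / (⨅ n, (w n : ℝ)))))))) ∧
      -- for fixed K and m, and every fixed ε, the running time is polynomial
      (∀ (K m : ℕ) (ε : ℝ), 1 ≤ K → 2 ≤ m → 0 < ε → ε ≤ 1 →
        ∃ a : ℕ, ∀ (N D : ℕ) (x : Fin N → EuclideanSpace ℝ (Fin D)) (w : Fin N → NNRat),
          1 ≤ N → 1 ≤ D →
          ∀ (t : ℕ) (s : RealRAM.Store),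
            RealRAM.Run p (RealRAM.input K m ε x (fun n => (w n : ℝ))) t s →
            t ≤ a * D * N ^ a) := by
  refine ⟨RealRAM.fuzzyProgram, 281 * 36, by norm_num, ?_, ?_⟩
  · intro N D K m ε x w hN hD hK hm hε hε1
    have hL : 1 ≤ ⌈8 / ε⌉₊ := Nat.ceil_pos.2 (by positivity)
    obtain ⟨t, s, hrun, ht, hmem, hcost⟩ := RealRAM.ends_fuzzyProgram (x := x)
      (w := fun n => (w n : ℝ)) (fun n => by positivity) hN hD hK hm hε hε1
      (RealRAM.sizesLE_max_pow (N := N) hK (by omega) hL)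
    refine ⟨t, s, hrun, hmem, hcost, fun hw => ?_⟩
    have hH : 2 ≤ K * ⌈8 / ε⌉₊ * m :=
      hm.trans (Nat.le_mul_of_pos_left _ (Nat.mul_pos hK hL))
    have ht' := RealRAM.time_le_max_pow hD hH ht
    have : Nonempty (Fin N) := ⟨⟨0, hN⟩⟩
    have hexp := exponent_le hK hm hε hε1 (zero_le_log_iSup_div_iInf
      (w := fun n => (w n : ℝ)) fun n => by exact_mod_cast hw n)
    have hX : (1 : ℝ) ≤ max (N : ℝ) 2 := le_trans (by norm_num) (le_max_right _ _)
    calc (t : ℝ) ≤ D * max (N : ℝ) 2 ^ ((2 * 140 + 1) * (K * ⌈8 / ε⌉₊ * m)) := by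
          exact_mod_cast ht'
      _ = D * max (N : ℝ) 2 ^ (281 * ((K * ⌈8 / ε⌉₊ * m : ℕ) : ℝ)) := by
          rw [← Real.rpow_natCast]
          push_cast
          norm_num
      _ ≤ _ := by
          refine mul_le_mul_of_nonneg_left (Real.rpow_le_rpow_of_exponent_le hX ?_) (by positivity)
          rw [mul_assoc (281 : ℝ) 36]
          exact mul_le_mul_of_nonneg_left hexp (by norm_num)
  · intro K m ε hK hm hε hε1
    have hL : 1 ≤ ⌈8 / ε⌉₊ := Nat.ceil_pos.2 (by positivity)
    set H := K * ⌈8 / ε⌉₊ * m with hHdef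
    have hH : 1 ≤ H := Nat.mul_pos (Nat.mul_pos hK hL) (by omega)
    -- The number `a` is both coefficient and exponent, so it is the sum of what each requires. The
    -- 5 comes from `U + 4 ≤ 5 * U`, the 2 from `D + 1 ≤ 2 * D`.
    refine ⟨2 * (5 * H) ^ 140 + H * 140, fun N D x w hN hD t s hrun => ?_⟩
    obtain ⟨t', s', hrun', ht, -⟩ := RealRAM.ends_fuzzyProgram (x := x)
      (w := fun n => (w n : ℝ)) (fun n => by positivity) hN hD hK hm hε hε1
      (RealRAM.sizesLE_mul_pow hN hK (by omega) hL)
    -- By determinism the given run takes the same time as the one whose running time has been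
    -- bounded.
    rw [(hrun.unique hrun').1]
    have hU : 1 ≤ H * N ^ H := Nat.mul_pos hH (Nat.pow_pos hN)
    calc t' ≤ (D + 1) * (H * N ^ H + 4) ^ 140 := ht
      _ ≤ (2 * D) * (5 * (H * N ^ H)) ^ 140 :=
          Nat.mul_le_mul (by omega) (Nat.pow_le_pow_left (by omega) _)
      _ = 2 * (5 * H) ^ 140 * D * N ^ (H * 140) := by
          rw [pow_mul N H 140, ← mul_assoc 5 H, mul_pow (5 * H)]
          ac_rfl
      _ ≤ (2 * (5 * H) ^ 140 + H * 140) * D * N ^ (2 * (5 * H) ^ 140 + H * 140) :=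
          Nat.mul_le_mul (Nat.mul_le_mul_right _ (Nat.le_add_right _ _))
            (Nat.pow_le_pow_right hN (Nat.le_add_left _ _))
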